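/- Let $n\ge 0$ and let $L,J$ be complex $2n\times 2n$ matrices, $L$ Hermitian, $J$ invertible and skew-Hermitian. Suppose that $L$ and $J$ are real with respect to a unitary antiholomorphic involution $I$ of $\mathbb{C}^{2n}$, i.e. they commute with a conjugate-linear map $I$ satisfying $I^2=\mathrm{id}$ and $\|I(u)\|=\|u\|$ for the Euclidean norm. Put $K:=(iJ)^{-1}$, $\mathcal L(\lambda):=L-\lambda K$ and $\sigma(\mathcal L):=\{\lambda\in\mathbb{C}:\det\mathcal L(\lambda)=0\}$. Let $N_-(L)$ be the number of negative eigenvalues of $L$, counted with multiplicity; let $2n_{\mathrm u}$ be the total algebraic multiplicity of the eigenvalues $\nu$ of $JL$ with $\mathrm{Re}\,\nu\ne 0$; and let $\mathrm{gKer}(JL)$ be the generalized kernel of $JL$. The set $\sigma(\mathcal L)$ is finite, the total multiplicity denoted $2n_{\mathrm u}$ is even, and there are $2n$ real-analytic functions $\mu_1,\dots,\mu_{2n}:\mathbb{R}\to\mathbb{R}$ (the eigenvalue curves) such that for each real $\lambda$ the numbers $\mu_1(\lambda),\dots,\mu_{2n}(\lambda)$ are the eigenvalues of $\mathcal L(\lambda)$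 repeated according to multiplicity. For any such system of curves define the following. If $\mu$ is a curve vanishing at $\lambda_0\in\mathbb{R}$ to order $m$ (so that $\mu^{(m)}(\lambda_0)\neq 0$ is its first nonzero derivative) and $\eta:=\mathrm{sign}\,\mu^{(m)}(\lambda_0)$, let $\kappa^\pm(\mu,\lambda_0):=\frac m2$ for $m$ even and $\kappa^\pm(\mu,\lambda_0):=\frac12(m\pm\eta)$ for $m$ odd; the Krein indices $\kappa^\pm(\lambda_0)$ are the sums of $\kappa^\pm(\mu_j,\lambda_0)$ over all curves with $\mu_j(\lambda_0)=0$. Let $Z^\downarrow_+$ (respectively $Z^\downarrow_-$) be the number of curves with $\mu_j(0)=0$ that are negative for sufficiently small positive (respectively negative) $\lambda$; let $Z^\uparrow_\pm$ be defined in the same way with ``positive'' in place of ``negative'' for the values of the curve; and let $Z^+(\mathcal L)$ (respectively $Z^-(\mathcal L)$) be the number of curves with $\mu_j(0)=0$ whose first nonzero derivative at $0$ is positive (respectively negative). Finally put $$\zeta:=\tfrac12\dim\mathrm{gKer}(JL)-\tfrac12\bigl(Z^\downarrow_++Z^\downarrow_-\bigr).$$ Then equivalently $$\zeta=\tfrac12\bigl(\dim\mathrm{gKer}(JL)-2\dim\mathrm{Ker}(L)\bigr)+\tfrac12\bigl(Z^\uparrow_++Z^\uparrow_-\bigr),$$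 and $$n_{\mathrm u}=N_-(L)-\zeta-2\sum_{\lambda\in\sigma(\mathcal L),\,\lambda>0}\kappa^+(\lambda)=N_-(L)-\zeta-2\sum_{\lambda\in\sigma(\mathcal L),\,\lambda<0}\kappa^-(\lambda).$$ Moreover $$\zeta=\tfrac12\dim\mathrm{gKer}(JL)-Z^-(\mathcal L)=\tfrac12\bigl(\dim\mathrm{gKer}(JL)-2\dim\mathrm{Ker}(L)\bigr)+Z^+(\mathcal L),$$ and if $\dim\mathrm{gKer}(JL)=2\dim\mathrm{Ker}(L)$, then $\zeta=Z^+(\mathcal L)$. -/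

import Mathlib

open Filter Topology

noncomputable section

namespace HamiltonianIndex

variable {N : ℕ}

/-- The linear pencil `𝓛(z) = L - z K` with `K = (i J)⁻¹`. -/
def pencil (L J : Matrix (Fin N) (Fin N) ℂ) (z : ℂ) : Matrix (Fin N) (Fin N) ℂ :=
  L - z • (Complex.I • J)⁻¹

/-- The spectrum `σ(𝓛)`: the set of characteristic values of the pencil. -/
def charValues (L J : Matrix (Fin N) (Fin N) ℂ) : Set ℂ :=
  {z | (pencil L J z).det = 0}

/-- A matrix is real with respect to a conjugate-linear isometric map `I` of `ℂ^N` (with its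
Euclidean norm) if it commutes with `I`. -/
def IsRealWrt (I : EuclideanSpace ℂ (Fin N) →ₗᵢ⋆[ℂ] EuclideanSpace ℂ (Fin N))
    (A : Matrix (Fin N) (Fin N) ℂ) : Prop :=
  ∀ u : EuclideanSpace ℂ (Fin N), Matrix.toEuclideanLin A (I u) = I (Matrix.toEuclideanLin A u)

/-- `N_-(L)`: the number of negative eigenvalues of a Hermitian matrix, with multiplicity. -/
def negIndex {L : Matrix (Fin N) (Fin N) ℂ} (hL : L.IsHermitian) : ℕ :=
  Set.ncard {i | hL.eigenvalues i < 0}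

/-- The total algebraic multiplicity of the eigenvalues of `A` off the imaginary axis. -/
def unstableMultiplicity (A : Matrix (Fin N) (Fin N) ℂ) : ℕ :=
  Multiset.card (A.charpoly.roots.filter fun ν => ν.re ≠ 0)

/-- `dim Ker A`. -/
def dimKer (A : Matrix (Fin N) (Fin N) ℂ) : ℕ :=
  Module.finrank ℂ (LinearMap.ker (Matrix.toLin' A))

/-- `dim gKer A`, the dimension of the generalized kernel `⋃ₖ Ker Aᵏ`. -/
def dimGKer (A : Matrix (Fin N) (Fin N) ℂ) : ℕ :=
  Module.finrank ℂ (Module.End.maxGenEigenspace (Matrix.toLin' A) (0 : ℂ))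

/-- `μ` is the system of the `N` real-analytic eigenvalue curves of the pencil, repeated according
to multiplicity: for every real `x`, the numbers `μ 0 x, …, μ (N-1) x` are the eigenvalues of
`𝓛(x)`, with multiplicity. -/
structure IsEigenvalueCurves (L J : Matrix (Fin N) (Fin N) ℂ) (μ : Fin N → ℝ → ℝ) : Prop where
  analytic : ∀ j x, AnalyticAt ℝ (μ j) x
  charpoly_eq : ∀ x : ℝ, (pencil L J (x : ℂ)).charpoly =
    ∏ j, (Polynomial.X - Polynomial.C ((μ j x : ℝ) : ℂ))

/-- The order `m` to which the analytic function `f` vanishes at `x₀`. -/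
def vanishingOrder (f : ℝ → ℝ) (x₀ : ℝ) : ℕ := analyticOrderNatAt f x₀

/-- The first nonzero derivative `f^(m)(x₀)`. -/
def leadingDeriv (f : ℝ → ℝ) (x₀ : ℝ) : ℝ := iteratedDeriv (vanishingOrder f x₀) f x₀

/-- The positive Krein index of the curve `f` at `x₀`. -/
def curveKreinPos (f : ℝ → ℝ) (x₀ : ℝ) : ℚ :=
  if Even (vanishingOrder f x₀) then (vanishingOrder f x₀ : ℚ) / 2
  else ((vanishingOrder f x₀ : ℚ) + (SignType.sign (leadingDeriv f x₀) : ℚ)) / 2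

/-- The negative Krein index of the curve `f` at `x₀`. -/
def curveKreinNeg (f : ℝ → ℝ) (x₀ : ℝ) : ℚ :=
  if Even (vanishingOrder f x₀) then (vanishingOrder f x₀ : ℚ) / 2
  else ((vanishingOrder f x₀ : ℚ) - (SignType.sign (leadingDeriv f x₀) : ℚ)) / 2

open Classical in
/-- `κ⁺(x₀)`: the sum over all curves through `(x₀, 0)`. -/
def kreinPos (μ : Fin N → ℝ → ℝ) (x₀ : ℝ) : ℚ :=
  ∑ j with μ j x₀ = 0, curveKreinPos (μ j) x₀

open Classical in
/-- `κ⁻(x₀)`: the sum over all curves through `(x₀, 0)`. -/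
def kreinNeg (μ : Fin N → ℝ → ℝ) (x₀ : ℝ) : ℚ :=
  ∑ j with μ j x₀ = 0, curveKreinNeg (μ j) x₀

/-- `Z_+^↓`: the number of curves through the origin that are negative for small `x > 0`. -/
def zDownRight (μ : Fin N → ℝ → ℝ) : ℕ := Set.ncard {j | μ j 0 = 0 ∧ ∀ᶠ x in 𝓝[>] 0, μ j x < 0}

/-- `Z_-^↓`: the number of curves through the origin that are negative for small `x < 0`. -/
def zDownLeft (μ : Fin N → ℝ → ℝ) : ℕ := Set.ncard {j | μ j 0 = 0 ∧ ∀ᶠ x in 𝓝[<] 0, μ j x < 0}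

/-- `Z_+^↑`: the number of curves through the origin that are positive for small `x > 0`. -/
def zUpRight (μ : Fin N → ℝ → ℝ) : ℕ := Set.ncard {j | μ j 0 = 0 ∧ ∀ᶠ x in 𝓝[>] 0, 0 < μ j x}

/-- `Z_-^↑`: the number of curves through the origin that are positive for small `x < 0`. -/
def zUpLeft (μ : Fin N → ℝ → ℝ) : ℕ := Set.ncard {j | μ j 0 = 0 ∧ ∀ᶠ x in 𝓝[<] 0, 0 < μ j x}

/-- `Z⁺`: the number of curves through the origin with positive first nonzero derivative. -/
def zPos (μ : Fin N → ℝ → ℝ) : ℕ := Set.ncard {j | μ j 0 = 0 ∧ 0 < leadingDeriv (μ j) 0}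

/-- `Z⁻`: the number of curves through the origin with negative first nonzero derivative. -/
def zNeg (μ : Fin N → ℝ → ℝ) : ℕ := Set.ncard {j | μ j 0 = 0 ∧ leadingDeriv (μ j) 0 < 0}

/-- `ζ = ½ dim gKer(JL) - ½ (Z_+^↓ + Z_-^↓)`. -/
def zeta (L J : Matrix (Fin N) (Fin N) ℂ) (μ : Fin N → ℝ → ℝ) : ℚ :=
  (dimGKer (J * L) : ℚ) / 2 - ((zDownRight μ : ℚ) + (zDownLeft μ : ℚ)) / 2

/-- `∑ κ⁺(x)` over the positive characteristic values `x`. -/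
def sumKreinPos (L J : Matrix (Fin N) (Fin N) ℂ) (μ : Fin N → ℝ → ℝ) : ℚ :=
  ∑ᶠ x ∈ {x : ℝ | (x : ℂ) ∈ charValues L J ∧ 0 < x}, kreinPos μ x

/-- `∑ κ⁻(x)` over the negative characteristic values `x`. -/
def sumKreinNeg (L J : Matrix (Fin N) (Fin N) ℂ) (μ : Fin N → ℝ → ℝ) : ℚ :=
  ∑ᶠ x ∈ {x : ℝ | (x : ℂ) ∈ charValues L J ∧ x < 0}, kreinNeg μ x

end HamiltonianIndex

end

namespace HamiltonianIndex

/-! The proof follows the signature (the sum of the signs of the eigenvalues) of `𝓛(x)` along the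
real axis. Reality with respect to `I` makes `𝓛(-x)` and `𝓛(x)` isospectral (`charpoly_pencil_neg`).
For large `x`, `𝓛(±x)` is a multiple of `∓K` plus a small perturbation, so its signatures at `x` and
`-x` are opposite; being also equal, they vanish (`eventually_signature_pencil_eq_zero`). Just to
the right of `0` the signature is `N - 2 N_-(L) - 2 Z_+^↓`. In between it changes only at
characteristic values, by twice the sum of the sign jumps `signJump` of the curves.

Each index `κ^±` is half of (vanishing order ± jump). At a real point the orders add up to the
multiplicity of a root of `specPoly`, the characteristic polynomial of `iJL`. Hence the sum of `κ⁺`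
over `x > 0` is determined by the number of positive roots, `N_-(L)` and `Z_+^↓`
(`two_mul_sumKreinPos`). Conjugation and `z ↦ -z` both preserve the roots of `specPoly`, so `N = 2
n_u + dim gKer(JL) + 2 #(positive roots)`. Eliminating the number of positive roots gives the
formula. Equality of the signatures on the two sides of `0` gives `Z_-^↓ = Z_+^↓`, which simplifies
`ζ`.

Existence of the curves is Rellich's theorem, proved here for monic real-rooted polynomials with
analytic coefficients. After centring, the sum of squares of the roots is analytic and nonnegative,
so it vanishes identically or to an even order `2r`. In the latter case, dividing the roots by `(t -
t₀)^r` leaves at least two distinct roots at `t₀`; a Hensel factorization and induction on the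
degree finish the local statement, and the identity theorem glues local systems. -/

open Polynomial in
/-- The monic real polynomial of degree `n` with prescribed lower coefficients. -/
noncomputable def monicOfFn (n : ℕ) (a : Fin n → ℝ) : ℝ[X] := X ^ n + ofFn n a

/-! ### Analytic factorization of monic polynomials into coprime factors -/

section MonicFamilies

open Polynomial
open scoped ContDiff

lemma monicOfFn_monic (n : ℕ) (a : Fin n → ℝ) : (monicOfFn n a).Monic :=
  monic_X_pow_add (ofFn_degree_lt a)

lemma monicOfFn_natDegree (n : ℕ) (a : Fin n → ℝ) : (monicOfFn n a).natDegree = n := by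
  have h : (monicOfFn n a).degree = n := by
    rw [monicOfFn, degree_add_eq_left_of_degree_lt] <;> rw [degree_X_pow]
    exact ofFn_degree_lt a
  exact natDegree_eq_of_degree_eq_some h

lemma monicOfFn_coeff_lt {n i : ℕ} (a : Fin n → ℝ) (hi : i < n) :
    (monicOfFn n a).coeff i = a ⟨i, hi⟩ := by
  simp [monicOfFn, coeff_X_pow, hi.ne, hi]

lemma eq_monicOfFn_of_monic {n : ℕ} {p : ℝ[X]} (hp : p.Monic) (hn : p.natDegree = n) :
    p = monicOfFn n (fun i => p.coeff i) := by
  have hm := monicOfFn_monic n (fun i => p.coeff i)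
  have hd := monicOfFn_natDegree n (fun i => p.coeff i)
  ext i
  rcases lt_trichotomy i n with h | rfl | h
  · rw [monicOfFn_coeff_lt _ h]
  · have h1 := hm.coeff_natDegree
    rw [hd] at h1
    rw [h1, ← hn, hp.coeff_natDegree]
  · rw [coeff_eq_zero_of_natDegree_lt (by omega), coeff_eq_zero_of_natDegree_lt (by omega)]

/-- Multiplication of monic polynomials in terms of their lower coefficients. -/
noncomputable def monicMul (k l : ℕ) (ab : (Fin k → ℝ) × (Fin l → ℝ)) : Fin (k + l) → ℝ :=
  fun i => (monicOfFn k ab.1 * monicOfFn l ab.2).coeff i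

lemma contDiff_coeff_monicOfFn (n j : ℕ) :
    ContDiff ℝ ω (fun a : Fin n → ℝ => (monicOfFn n a).coeff j) := by
  have h : (fun a : Fin n → ℝ => (monicOfFn n a).coeff j) = fun a =>
      (X ^ n : ℝ[X]).coeff j + ((lcoeff ℝ j ∘ₗ ofFn n).toContinuousLinearMap) a := by
    funext a
    simp [monicOfFn]
  rw [h]
  exact contDiff_const.add (ContinuousLinearMap.contDiff _)

lemma contDiff_monicMul (k l : ℕ) : ContDiff ℝ ω (monicMul k l) := by
  rw [contDiff_pi]
  intro i
  simp only [monicMul, coeff_mul]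
  refine ContDiff.sum fun x _ => ContDiff.mul ?_ ?_
  · exact (contDiff_coeff_monicOfFn k x.1).comp contDiff_fst
  · exact (contDiff_coeff_monicOfFn l x.2).comp contDiff_snd

/-- Along a line in direction `uv` the product is quadratic in the parameter `t`; the derivative is
the coefficient of `t`. -/
lemma fderiv_monicMul_apply (k l : ℕ) (ab uv : (Fin k → ℝ) × (Fin l → ℝ)) (i : Fin (k + l)) :
    fderiv ℝ (monicMul k l) ab uv i =
      (ofFn k uv.1 * monicOfFn l ab.2 + monicOfFn k ab.1 * ofFn l uv.2).coeff i := by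
  have hd : HasFDerivAt (monicMul k l) (fderiv ℝ (monicMul k l) ab) ab :=
    ((contDiff_monicMul k l).differentiable (by simp) ab).hasFDerivAt
  have h1 := hasDerivAt_pi.1 (hd.hasLineDerivAt uv) i
  set c := ofFn k uv.1 * monicOfFn l ab.2 + monicOfFn k ab.1 * ofFn l uv.2 with hc
  have h2 : HasDerivAt (fun t : ℝ => (monicMul k l ab i + t * c.coeff i) +
      t ^ 2 * (ofFn k uv.1 * ofFn l uv.2).coeff i) (c.coeff i) 0 := by
    have h3 := (((hasDerivAt_id (0 : ℝ)).mul_const (c.coeff i)).const_add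
      (monicMul k l ab i)).add (((hasDerivAt_id (0 : ℝ)).pow 2).mul_const
      ((ofFn k uv.1 * ofFn l uv.2).coeff i))
    refine h3.congr_deriv ?_
    simp
  refine h1.unique (h2.congr_of_eventuallyEq (Eventually.of_forall fun t => ?_))
  simp only [monicMul, hc, monicOfFn, Prod.fst_add, Prod.snd_add, Prod.smul_fst, Prod.smul_snd,
    map_add, map_smul]
  rw [show (X ^ k + (ofFn k ab.1 + t • ofFn k uv.1)) * (X ^ l + (ofFn l ab.2 + t • ofFn l uv.2))
    = ((X ^ k + ofFn k ab.1) * (X ^ l + ofFn l ab.2) + t • (ofFn k uv.1 * (X ^ l + ofFn l ab.2)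
      + (X ^ k + ofFn k ab.1) * ofFn l uv.2)) + t ^ 2 • (ofFn k uv.1 * ofFn l uv.2) by
    simp only [smul_eq_C_mul, C_pow]; ring]
  simp only [coeff_add, coeff_smul, smul_eq_mul]

/-- If `u q + p v = 0` with `p`, `q` coprime, then `p ∣ u` and `q ∣ v`; since `deg u < deg p` and
`deg v < deg q`, both vanish. -/
lemma fderiv_monicMul_injective {k l : ℕ} {ab : (Fin k → ℝ) × (Fin l → ℝ)}
    (h : IsCoprime (monicOfFn k ab.1) (monicOfFn l ab.2)) :
    Function.Injective (fderiv ℝ (monicMul k l) ab) := by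
  rw [injective_iff_map_eq_zero]
  intro uv huv
  have hz : ofFn k uv.1 * monicOfFn l ab.2 + monicOfFn k ab.1 * ofFn l uv.2 = 0 := by
    ext i
    by_cases hi : i < k + l
    · have := fderiv_monicMul_apply k l ab uv ⟨i, hi⟩
      rw [huv] at this
      simpa using this.symm
    · have hk := ofFn_degree_lt uv.1
      have hl := ofFn_degree_lt uv.2
      have hpk : (monicOfFn k ab.1).degree = k := by
        rw [degree_eq_natDegree (monicOfFn_monic _ _).ne_zero, monicOfFn_natDegree]
      have hpl : (monicOfFn l ab.2).degree = l := by
        rw [degree_eq_natDegree (monicOfFn_monic _ _).ne_zero, monicOfFn_natDegree]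
      rw [coeff_zero]
      refine coeff_eq_zero_of_degree_lt (lt_of_lt_of_le (b := ((k + l : ℕ) : WithBot ℕ)) ?_
        (by exact_mod_cast not_lt.1 hi))
      refine lt_of_le_of_lt (degree_add_le _ _) (max_lt ?_ ?_)
      · rw [degree_mul, hpl, Nat.cast_add]
        exact WithBot.add_lt_add_right (by simp) hk
      · rw [degree_mul, hpk, Nat.cast_add]
        exact WithBot.add_lt_add_left (by simp) hl
  have key : ∀ {n : ℕ} (u : Fin n → ℝ) (a : Fin n → ℝ), monicOfFn n a ∣ ofFn n u → u = 0 := by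
    intro n u a hdvd
    have h0 : ofFn n u = 0 := by
      refine eq_zero_of_dvd_of_degree_lt hdvd ?_
      rw [degree_eq_natDegree (monicOfFn_monic _ _).ne_zero, monicOfFn_natDegree]
      exact ofFn_degree_lt u
    exact injective_ofFn n (by rw [h0, map_zero])
  have h1 : uv.1 = 0 := by
    refine key uv.1 ab.1 (h.dvd_of_dvd_mul_right ?_)
    rw [eq_neg_of_add_eq_zero_left hz]
    exact (dvd_mul_right _ _).neg_right
  have h2 : uv.2 = 0 := by
    refine key uv.2 ab.2 (h.symm.dvd_of_dvd_mul_left ?_)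
    rw [eq_neg_of_add_eq_zero_right hz]
    exact (dvd_mul_left _ _).neg_right
  exact Prod.ext h1 h2

/-- Analytic Hensel lemma: a factorization into coprime monic factors of a member of an analytic
family of monic polynomials extends to nearby members of the family. -/
theorem exists_analytic_factorization {N : ℕ} {P : ℝ → ℝ[X]} {t₀ : ℝ}
    (hP : ∀ t, (P t).Monic) (hN : ∀ t, (P t).natDegree = N)
    (han : ∀ k, AnalyticAt ℝ (fun t => (P t).coeff k) t₀)
    {p q : ℝ[X]} (hp : p.Monic) (hq : q.Monic) (hpq : IsCoprime p q) (h : P t₀ = p * q) :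
    ∃ p' q' : ℝ → ℝ[X],
      ((∀ t, (p' t).Monic) ∧ (∀ t, (p' t).natDegree = p.natDegree) ∧
        ∀ k, AnalyticAt ℝ (fun t => (p' t).coeff k) t₀) ∧
      ((∀ t, (q' t).Monic) ∧ (∀ t, (q' t).natDegree = q.natDegree) ∧
        ∀ k, AnalyticAt ℝ (fun t => (q' t).coeff k) t₀) ∧
      ∀ᶠ t in 𝓝 t₀, P t = p' t * q' t := by
  obtain ⟨k, hk⟩ : ∃ k, p.natDegree = k := ⟨_, rfl⟩
  obtain ⟨l, hl⟩ : ∃ l, q.natDegree = l := ⟨_, rfl⟩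
  have hkl : N = k + l := by rw [← hN t₀, h, hp.natDegree_mul hq, hk, hl]
  subst hkl
  have hp' := eq_monicOfFn_of_monic hp hk
  have hq' := eq_monicOfFn_of_monic hq hl
  set a : Fin k → ℝ := fun i => p.coeff i
  set b : Fin l → ℝ := fun i => q.coeff i
  have hcop : IsCoprime (monicOfFn k (a, b).1) (monicOfFn l (a, b).2) := by
    simpa only [← hp', ← hq'] using hpq
  have hinj := fderiv_monicMul_injective hcop
  -- Both sides have dimension `k + l`, so the injective derivative is invertible and the analytic
  -- inverse function theorem applies.
  let e : ((Fin k → ℝ) × (Fin l → ℝ)) ≃L[ℝ] (Fin (k + l) → ℝ) :=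
    (LinearEquiv.ofInjectiveOfFinrankEq
      (fderiv ℝ (monicMul k l) (a, b) : _ →ₗ[ℝ] _) hinj (by simp)).toContinuousLinearEquiv
  have hcd : ContDiffAt ℝ ω (monicMul k l) (a, b) := (contDiff_monicMul k l).contDiffAt
  have hfd : HasFDerivAt (monicMul k l) (e : _ →L[ℝ] _) (a, b) := by
    have he : (e : _ →L[ℝ] _) = fderiv ℝ (monicMul k l) (a, b) :=
      ContinuousLinearMap.ext fun _ => rfl
    rw [he]
    exact ((contDiff_monicMul k l).differentiable (by simp) (a, b)).hasFDerivAt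
  have hω : (ω : WithTop ℕ∞) ≠ 0 := by simp
  let G := hcd.localInverse hfd hω
  have hG : ContDiffAt ℝ ω G (monicMul k l (a, b)) := hcd.to_localInverse hfd hω
  have hright : ∀ᶠ y in 𝓝 (monicMul k l (a, b)), monicMul k l (G y) = y :=
    (hcd.hasStrictFDerivAt' hfd hω).eventually_right_inverse
  let c : ℝ → Fin (k + l) → ℝ := fun t i => (P t).coeff i
  have hc0 : c t₀ = monicMul k l (a, b) := by
    funext i
    simp only [c, monicMul, h, ← hp', ← hq']
  have hc : ContDiffAt ℝ ω c t₀ := by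
    rw [contDiffAt_pi]
    exact fun i => (han i).contDiffAt
  have hGc : ContDiffAt ℝ ω (fun t => G (c t)) t₀ := by
    rw [← hc0] at hG
    exact hG.comp t₀ hc
  refine ⟨fun t => monicOfFn k (G (c t)).1, fun t => monicOfFn l (G (c t)).2,
    ⟨fun t => monicOfFn_monic _ _, fun t => (monicOfFn_natDegree _ _).trans hk.symm, fun j => ?_⟩,
    ⟨fun t => monicOfFn_monic _ _, fun t => (monicOfFn_natDegree _ _).trans hl.symm, fun j => ?_⟩,
    ?_⟩
  · exact ((contDiff_coeff_monicOfFn k j).contDiffAt.comp t₀ hGc.fst).analyticAt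
  · exact ((contDiff_coeff_monicOfFn l j).contDiffAt.comp t₀ hGc.snd).analyticAt
  · have hcont : Tendsto c (𝓝 t₀) (𝓝 (monicMul k l (a, b))) := by
      rw [← hc0]; exact hc.continuousAt
    filter_upwards [hcont.eventually hright] with t ht
    rw [eq_monicOfFn_of_monic (hP t) (hN t), eq_monicOfFn_of_monic
      ((monicOfFn_monic k (G (c t)).1).mul (monicOfFn_monic l (G (c t)).2))
      (by rw [(monicOfFn_monic _ _).natDegree_mul (monicOfFn_monic _ _), monicOfFn_natDegree,
        monicOfFn_natDegree])]
    congr 1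
    exact ht.symm

end MonicFamilies

/-! ### Real-rooted families: power sums, orders of vanishing, limits -/

section HyperbolicFamilies

open Polynomial

/-- A family of monic real polynomials of degree `N`, with coefficients analytic at `t₀`, all of
whose members near `t₀` have only real roots. -/
structure IsHyperbolicFamily (N : ℕ) (P : ℝ → ℝ[X]) (t₀ : ℝ) : Prop where
  monic : ∀ t, (P t).Monic
  natDegree_eq : ∀ t, (P t).natDegree = N
  analyticAt_coeff : ∀ k, AnalyticAt ℝ (fun t => (P t).coeff k) t₀
  splits : ∀ᶠ t in 𝓝 t₀, (P t).Splits

lemma IsHyperbolicFamily.taylor {N : ℕ} {P : ℝ → ℝ[X]} {t₀ : ℝ} (h : IsHyperbolicFamily N P t₀)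
    {c : ℝ → ℝ} (hc : AnalyticAt ℝ c t₀) :
    IsHyperbolicFamily N (fun t => Polynomial.taylor (c t) (P t)) t₀ where
  monic t := by
    rw [Monic, leadingCoeff_taylor]; exact h.monic t
  natDegree_eq t := by rw [natDegree_taylor, h.natDegree_eq]
  analyticAt_coeff k := by
    have he : (fun t => (Polynomial.taylor (c t) (P t)).coeff k) = fun t =>
        ∑ i ∈ Finset.range (N + 1), (((i + k).choose k : ℝ) * (P t).coeff (i + k)) * c t ^ i := by
      funext t
      rw [taylor_coeff, eval_eq_sum_range' (n := N + 1)]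
      · simp only [hasseDeriv_coeff]
      · have := natDegree_hasseDeriv_le (P t) k
        rw [h.natDegree_eq] at this
        omega
    rw [he]
    refine Finset.analyticAt_fun_sum _ fun i _ => ?_
    exact (analyticAt_const.mul (h.analyticAt_coeff _)).mul (hc.pow i)
  splits := by
    filter_upwards [h.splits] with t ht
    exact ht.taylor _

lemma roots_taylor_eq_map (p : ℝ[X]) (c : ℝ) :
    (taylor c p).roots = p.roots.map (fun x => x - c) := by
  have := roots_comp_C_mul_X_add_C p 1 c isUnit_one
  simpa [taylor_apply] using this

lemma sum_sq_eq_sq_sum_sub_esymm (s : Multiset ℝ) :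
    (s.map (fun x => x ^ 2)).sum = s.sum ^ 2 - 2 * s.esymm 2 := by
  induction s using Multiset.induction_on with
  | empty => simp [Multiset.esymm, Multiset.powersetCard_zero_right]
  | cons a s ih =>
    have h1 : (a ::ₘ s).esymm 2 = s.esymm 2 + a * s.sum := by
      have h2 : (s.map fun x => a * x).sum = a * s.sum := by
        rw [Multiset.sum_map_mul_left, Multiset.map_id']
      rw [← h2]
      simp only [Multiset.esymm, Multiset.powersetCard_cons 1, Multiset.map_add, Multiset.map_map,
        Multiset.sum_add, Function.comp_def, Multiset.prod_cons, Multiset.powersetCard_one,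
        Multiset.prod_singleton]
    rw [h1, Multiset.map_cons, Multiset.sum_cons, Multiset.sum_cons, ih]
    ring

lemma sum_roots_eq_neg_coeff {N : ℕ} {p : ℝ[X]} (hp : p.Monic) (hN : p.natDegree = N + 1)
    (hs : p.Splits) : p.roots.sum = -p.coeff N := by
  have := hs.nextCoeff_eq_neg_sum_roots_of_monic hp
  rw [nextCoeff_of_natDegree_pos (by omega), hN] at this
  simp at this
  linarith

/-- By Newton's identity the sum of squares is a polynomial in the two coefficients below the
leading one. Degrees `0` and `1` are separate because they lack those coefficients. -/
lemma IsHyperbolicFamily.exists_analytic_sum_sq {N : ℕ} {P : ℝ → ℝ[X]} {t₀ : ℝ}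
    (h : IsHyperbolicFamily N P t₀) : ∃ w : ℝ → ℝ, AnalyticAt ℝ w t₀ ∧
      ∀ t, (P t).Splits → ((P t).roots.map (fun x => x ^ 2)).sum = w t := by
  match N, h with
  | 0, h =>
    refine ⟨fun _ => 0, analyticAt_const, fun t ht => ?_⟩
    have h0 : (P t).roots = 0 := by
      rw [← Multiset.card_eq_zero, ← ht.natDegree_eq_card_roots, h.natDegree_eq]
    simp [h0]
  | 1, h =>
    refine ⟨fun t => (-(P t).coeff 0) ^ 2, ((h.analyticAt_coeff 0).neg).pow 2, fun t ht => ?_⟩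
    obtain ⟨a, ha⟩ := Multiset.card_eq_one.1 (ht.natDegree_eq_card_roots.symm.trans
      (h.natDegree_eq t))
    have := sum_roots_eq_neg_coeff (h.monic t) (h.natDegree_eq t) ht
    change _ = (-(P t).coeff 0) ^ 2
    rw [← this, ha]
    simp
  | N + 2, h =>
    refine ⟨fun t => (-(P t).coeff (N + 1)) ^ 2 - 2 * (P t).coeff N,
      (((h.analyticAt_coeff _).neg).pow 2).sub (analyticAt_const.mul (h.analyticAt_coeff _)),
      fun t ht => ?_⟩
    have h1 := sum_roots_eq_neg_coeff (h.monic t) (h.natDegree_eq t) ht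
    have h2 := coeff_eq_esymm_roots_of_splits ht (k := N) (by rw [h.natDegree_eq]; omega)
    rw [h.natDegree_eq, (h.monic t).leadingCoeff, show N + 2 - N = 2 by omega] at h2
    change _ = (-(P t).coeff (N + 1)) ^ 2 - 2 * (P t).coeff N
    rw [sum_sq_eq_sq_sum_sub_esymm, h1, h2]
    ring

/-- The right side of `t₀` forces `g t₀ > 0`; an odd power would then be negative on the left. -/
lemma even_and_pos_of_nonneg_pow_mul {g : ℝ → ℝ} {t₀ : ℝ} {m : ℕ} (hg : ContinuousAt g t₀)
    (hg0 : g t₀ ≠ 0) (h : ∀ᶠ t in 𝓝 t₀, 0 ≤ (t - t₀) ^ m * g t) : Even m ∧ 0 < g t₀ := by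
  have hpos : 0 < g t₀ := by
    refine lt_of_le_of_ne ?_ hg0.symm
    have h1 : ∀ᶠ t in 𝓝[>] t₀, 0 ≤ g t := by
      filter_upwards [h.filter_mono nhdsWithin_le_nhds, self_mem_nhdsWithin] with t ht ht'
      exact (mul_nonneg_iff_of_pos_left (pow_pos (sub_pos.2 ht') m)).1 ht
    exact ge_of_tendsto (hg.tendsto.mono_left nhdsWithin_le_nhds) h1
  refine ⟨?_, hpos⟩
  by_contra hm
  rw [Nat.not_even_iff_odd] at hm
  have h2 : ∀ᶠ t in 𝓝[<] t₀, False := by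
    filter_upwards [h.filter_mono nhdsWithin_le_nhds, self_mem_nhdsWithin,
      (hg.eventually (lt_mem_nhds hpos)).filter_mono nhdsWithin_le_nhds] with t h1 h2 h3
    have : (t - t₀) ^ m < 0 := hm.pow_neg (sub_neg.2 h2)
    nlinarith
  exact (h2.exists).elim fun _ h => h

/-- If the order were `m < n`, dividing the bound by `|t - t₀|^m` would force the leading factor to
vanish at `t₀`. -/
lemma exists_eq_pow_mul_of_le {f : ℝ → ℝ} {t₀ : ℝ} (hf : AnalyticAt ℝ f t₀) (n : ℕ) {C : ℝ}
    (h : ∀ᶠ t in 𝓝 t₀, |f t| ≤ C * |t - t₀| ^ n) :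
    ∃ g : ℝ → ℝ, AnalyticAt ℝ g t₀ ∧ ∀ᶠ t in 𝓝 t₀, f t = (t - t₀) ^ n * g t := by
  simp only [← smul_eq_mul]
  rw [← natCast_le_analyticOrderAt hf (n := n)]
  by_contra hlt
  rw [not_le] at hlt
  obtain ⟨m, hm⟩ := ENat.ne_top_iff_exists.1 hlt.ne_top
  rw [← hm, Nat.cast_lt] at hlt
  obtain ⟨g, hg, hg0, hfg⟩ := hf.analyticOrderAt_eq_natCast.1 hm.symm
  obtain ⟨d, rfl⟩ := Nat.exists_eq_add_of_lt hlt
  have h1 : ∀ᶠ t in 𝓝[≠] t₀, |g t| ≤ C * |t - t₀| ^ (d + 1) := by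
    filter_upwards [h.filter_mono nhdsWithin_le_nhds, hfg.filter_mono nhdsWithin_le_nhds,
      self_mem_nhdsWithin] with t h1 h2 h3
    have hp : 0 < |t - t₀| ^ m := pow_pos (abs_pos.2 (sub_ne_zero.2 h3)) m
    rw [h2, smul_eq_mul, abs_mul, abs_pow, show m + d + 1 = m + (d + 1) by ring, pow_add] at h1
    refine le_of_mul_le_mul_left (h1.trans_eq ?_) hp
    ring
  have h2 : Tendsto (fun t => C * |t - t₀| ^ (d + 1)) (𝓝[≠] t₀) (𝓝 0) := by
    have : ContinuousAt (fun t => C * |t - t₀| ^ (d + 1)) t₀ := by fun_prop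
    have h3 := this.tendsto.mono_left (nhdsWithin_le_nhds (s := {t₀}ᶜ))
    simpa using h3
  have h3 := le_of_tendsto_of_tendsto
    ((hg.continuousAt.abs.tendsto).mono_left nhdsWithin_le_nhds) h2 h1
  exact hg0 (abs_nonpos_iff.1 h3)

/-- Root vectors along a sequence tending to `t₀` stay in a compact cube; the limit of a convergent
subsequence lists the roots of `Q t₀`. -/
lemma splits_of_eventually_splits {N : ℕ} {Q : ℝ → ℝ[X]} {t₀ : ℝ} (hm : ∀ t, (Q t).Monic)
    (hN : ∀ t, (Q t).natDegree = N) (hc : ∀ k, ContinuousAt (fun t => (Q t).coeff k) t₀) {B : ℝ}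
    (h : ∀ᶠ t in 𝓝[≠] t₀, (Q t).Splits ∧ ∀ z ∈ (Q t).roots, |z| ≤ B) : (Q t₀).Splits := by
  have hex : ∀ t, (Q t).Splits → (∀ z ∈ (Q t).roots, |z| ≤ B) →
      ∃ y : Fin N → ℝ, (Q t) = ∏ j, (X - C (y j)) ∧ y ∈ Set.pi Set.univ fun _ => Set.Icc (-B) B := by
    intro t ht hB
    obtain ⟨l, hl⟩ := Quot.exists_rep (Q t).roots
    have hlen : l.length = N := by
      rw [← hN t, ht.natDegree_eq_card_roots, ← hl]; rfl
    subst hlen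
    refine ⟨l.get, ?_, fun i _ => abs_le.1 (hB _ ?_)⟩
    · conv_lhs => rw [ht.eq_prod_roots_of_monic (hm t), ← hl]
      change (Multiset.map _ (l : Multiset ℝ)).prod = _
      rw [Multiset.map_coe, Multiset.prod_coe, ← List.prod_ofFn]
      congr 1
      conv_lhs => rw [← List.ofFn_get l]
      rw [List.map_ofFn]
      rfl
    · rw [← hl]
      exact Multiset.mem_coe.2 (List.get_mem l i)
  have hseq : Tendsto (fun n : ℕ => t₀ + 1 / ((n : ℝ) + 1)) atTop (𝓝[≠] t₀) := by
    refine tendsto_nhdsWithin_iff.2 ⟨?_, Eventually.of_forall fun n => ?_⟩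
    · simpa using (tendsto_one_div_add_atTop_nhds_zero_nat (𝕜 := ℝ)).const_add t₀
    · have : (0 : ℝ) < 1 / ((n : ℝ) + 1) := by positivity
      simp only [Set.mem_compl_iff, Set.mem_singleton_iff]
      linarith
  obtain ⟨n₀, hn₀⟩ := eventually_atTop.1 (hseq.eventually h)
  choose y hy hyK using fun n : ℕ => hex _ (hn₀ (n + n₀) (by omega)).1 (hn₀ (n + n₀) (by omega)).2
  obtain ⟨y₀, -, φ, hφ, hlim⟩ :=
    (isCompact_univ_pi fun _ : Fin N => isCompact_Icc (a := -B) (b := B)).tendsto_subseq hyK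
  have hpt : Tendsto (fun n : ℕ => t₀ + 1 / (((φ n + n₀ : ℕ) : ℝ) + 1)) atTop (𝓝 t₀) := by
    have h1 : Tendsto (fun n => φ n + n₀) atTop atTop :=
      tendsto_atTop_mono (fun n => Nat.le_add_right _ _) hφ.tendsto_atTop
    exact ((hseq.mono_right nhdsWithin_le_nhds).comp h1)
  have heq : Q t₀ = ∏ j, (X - C (y₀ j)) := by
    refine Polynomial.funext fun x => ?_
    have h1 : ContinuousAt (fun t => (Q t).eval x) t₀ := by
      have : (fun t => (Q t).eval x) = fun t =>
          ∑ i ∈ Finset.range (N + 1), (Q t).coeff i * x ^ i := by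
        funext t
        rw [eval_eq_sum_range' (n := N + 1) (by rw [hN]; omega)]
      rw [this]
      exact tendsto_finsetSum _ fun i _ => (hc i).mul continuousAt_const
    have h2 := h1.tendsto.comp hpt
    have h3 : Tendsto (fun n => ∏ j, (x - (y ∘ φ) n j)) atTop (𝓝 (∏ j, (x - y₀ j))) :=
      tendsto_finsetProd _ fun j _ => tendsto_const_nhds.sub ((tendsto_pi_nhds.1 hlim) j)
    have h4 : (eval x (∏ j, (X - C (y₀ j)))) = ∏ j, (x - y₀ j) := by simp [eval_prod]
    rw [h4]
    refine tendsto_nhds_unique (h2.congr fun n => ?_) h3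
    simp only [Function.comp_apply]
    rw [hy (φ n)]
    simp [eval_prod]
  rw [heq]
  exact Splits.prod fun j _ => Splits.X_sub_C _

lemma exists_coprime_factorization {N : ℕ} {p : ℝ[X]} (hp : p.Monic) (hN : p.natDegree = N)
    (hsum : p.roots.sum = 0) (hsq : (p.roots.map (fun x => x ^ 2)).sum ≠ 0) :
    ∃ q r : ℝ[X], q.Monic ∧ r.Monic ∧ IsCoprime q r ∧ p = q * r ∧ q.natDegree < N ∧
      r.natDegree < N := by
  obtain ⟨y, hy, hy0⟩ : ∃ y ∈ p.roots, y ≠ 0 := by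
    by_contra! hcon
    apply hsq
    refine Multiset.sum_eq_zero fun x hx => ?_
    obtain ⟨z, hz, rfl⟩ := Multiset.mem_map.1 hx
    simp [hcon z hz]
  obtain ⟨r, hr, hrd⟩ := exists_eq_pow_rootMultiplicity_mul_and_not_dvd p hp.ne_zero y
  set k := rootMultiplicity y p with hk
  have hkpos : 0 < k := (rootMultiplicity_pos hp.ne_zero).2 (isRoot_of_mem_roots hy)
  have hqm : ((X - C y) ^ k).Monic := (monic_X_sub_C y).pow k
  have hrm : r.Monic := hqm.of_mul_monic_left (hr ▸ hp)
  have hdeg : N = k + r.natDegree := by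
    rw [← hN, hr, hqm.natDegree_mul hrm, natDegree_pow, natDegree_X_sub_C, mul_one]
  refine ⟨(X - C y) ^ k, r, hqm, hrm, IsCoprime.pow_left
    (((irreducible_X_sub_C y).coprime_iff_not_dvd).2 hrd), hr, ?_, by omega⟩
  rw [natDegree_pow, natDegree_X_sub_C, mul_one]
  -- Otherwise `p = (X - y)^N`, whose roots sum to `N y ≠ 0`, contrary to centring.
  by_contra hlt
  have hr1 : r = 1 := hrm.natDegree_eq_zero.1 (by omega)
  rw [hr, hr1, mul_one, roots_pow, roots_X_sub_C, Multiset.sum_nsmul] at hsum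
  simp only [Multiset.sum_singleton, smul_eq_zero] at hsum
  rcases hsum with h | h
  · omega
  · exact hy0 h

end HyperbolicFamilies

/-! ### Rellich's theorem near a point -/

section LocalAnalyticRoots

open Polynomial

/-- The factor `0` is allowed because `(t - t₀)^r` may vanish at `t₀`; splitting then supplies the
right number of zero roots. -/
lemma roots_scaleRoots_of_splits {p : ℝ[X]} (hp : p.Monic) (hs : p.Splits) (r : ℝ) :
    (p.scaleRoots r).roots = p.roots.map (fun x => r * x) := by
  rcases eq_or_ne r 0 with rfl | hr
  · rw [scaleRoots_zero, hp.leadingCoeff, one_smul, roots_X_pow, hs.natDegree_eq_card_roots]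
    simp [Multiset.map_const', Multiset.nsmul_singleton]
  · exact roots_scaleRoots p hr.isUnit

lemma sum_sq_map_mul (s : Multiset ℝ) (r : ℝ) :
    ((s.map (fun x => r * x)).map (fun x => x ^ 2)).sum =
      r ^ 2 * (s.map (fun x => x ^ 2)).sum := by
  rw [Multiset.map_map, ← Multiset.sum_map_mul_left]
  exact congrArg Multiset.sum (Multiset.map_congr rfl fun x _ => by
    simp only [Function.comp_apply]; ring)

lemma sq_le_sum_sq {s : Multiset ℝ} {z : ℝ} (hz : z ∈ s) :
    z ^ 2 ≤ (s.map (fun x => x ^ 2)).sum := by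
  refine Multiset.single_le_sum (fun x hx => ?_) _ (Multiset.mem_map_of_mem _ hz)
  obtain ⟨y, -, rfl⟩ := Multiset.mem_map.1 hx
  positivity

/-- A centred hyperbolic family that is not identically `X ^ N` is obtained by scaling the roots of
another hyperbolic family, whose member at `t₀` has at least two different roots. -/
lemma IsHyperbolicFamily.exists_scaleRoots {n : ℕ} {P : ℝ → ℝ[X]} {t₀ : ℝ}
    (h : IsHyperbolicFamily (n + 1) P t₀) (hsum : ∀ᶠ t in 𝓝 t₀, (P t).roots.sum = 0)
    (hne : ¬ ∀ᶠ t in 𝓝 t₀, ((P t).roots.map (fun x => x ^ 2)).sum = 0) :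
    ∃ (Q : ℝ → ℝ[X]) (r : ℕ), IsHyperbolicFamily (n + 1) Q t₀ ∧
      (∀ᶠ t in 𝓝 t₀, P t = (Q t).scaleRoots ((t - t₀) ^ r)) ∧ (Q t₀).roots.sum = 0 ∧
      ((Q t₀).roots.map (fun x => x ^ 2)).sum ≠ 0 := by
  obtain ⟨w, hw, hPw⟩ := h.exists_analytic_sum_sq
  have hw0 : ¬ ∀ᶠ t in 𝓝 t₀, w t = 0 := by
    intro hcon
    apply hne
    filter_upwards [hcon, h.splits] with t h1 h2
    rw [hPw t h2, h1]
  obtain ⟨m, g, hg, hg0, hwg⟩ := hw.exists_eventuallyEq_pow_smul_nonzero_iff.2 hw0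
  have hnonneg : ∀ᶠ t in 𝓝 t₀, 0 ≤ (t - t₀) ^ m * g t := by
    filter_upwards [hwg, h.splits] with t h1 h2
    rw [← smul_eq_mul, ← h1, ← hPw t h2]
    refine Multiset.sum_nonneg fun x hx => ?_
    obtain ⟨y, -, rfl⟩ := Multiset.mem_map.1 hx
    positivity
  obtain ⟨⟨r, rfl⟩, hgpos⟩ := even_and_pos_of_nonneg_pow_mul hg.continuousAt hg0 hnonneg
  -- Near `t₀` every root satisfies `z² ≤ (t - t₀)^(2r) g(t)` with `g(t) < g(t₀) + 1`, hence `|z| ≤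
  -- C |t - t₀|^r`.
  set C := Real.sqrt (g t₀ + 1) with hC
  have hroot : ∀ᶠ t in 𝓝 t₀, ∀ z ∈ (P t).roots, |z| ≤ C * |t - t₀| ^ r := by
    filter_upwards [hwg, h.splits, hg.continuousAt.eventually
      (gt_mem_nhds (lt_add_one (g t₀)))] with t h1 h2 h3 z hz
    have h4 := sq_le_sum_sq hz
    rw [hPw t h2, h1, smul_eq_mul] at h4
    refine abs_le_of_sq_le_sq ?_ (by positivity)
    rw [mul_pow, hC, Real.sq_sqrt (by linarith), ← pow_mul, mul_comm r 2, pow_mul, sq_abs, ← pow_mul,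
      mul_comm (_ + 1), two_mul]
    exact h4.trans (mul_le_mul_of_nonneg_left h3.le ((Even.add_self r).pow_nonneg _))
  -- Up to sign, coefficient `i` is the elementary symmetric function of degree `n + 1 - i` in roots
  -- of size `O(|t - t₀|^r)`, so this power divides it.
  have hcoeff : ∀ i : Fin (n + 1), ∃ b : ℝ → ℝ, AnalyticAt ℝ b t₀ ∧
      ∀ᶠ t in 𝓝 t₀, (P t).coeff i = (t - t₀) ^ (r * (n + 1 - i)) * b t := by
    intro i
    refine exists_eq_pow_mul_of_le (h.analyticAt_coeff i) _
      (C := C ^ (n + 1 - i : ℕ) * ((n + 1).choose i : ℝ)) ?_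
    filter_upwards [hroot, h.splits] with t h1 h2
    have h3 := coeff_le_of_roots_le (f := RingHom.id ℝ) (B := C * |t - t₀| ^ r) (i : ℕ) (h.monic t)
      (by simpa using h2) (by simpa using h1)
    rw [Polynomial.map_id, h.natDegree_eq, Real.norm_eq_abs] at h3
    refine h3.trans_eq ?_
    rw [mul_pow, ← pow_mul]
    ring
  choose b hb hPb using hcoeff
  set Q : ℝ → ℝ[X] := fun t => monicOfFn (n + 1) (fun i => b i t) with hQdef
  have hQm : ∀ t, (Q t).Monic := fun t => monicOfFn_monic _ _
  have hQd : ∀ t, (Q t).natDegree = n + 1 := fun t => monicOfFn_natDegree _ _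
  have hQa : ∀ k, AnalyticAt ℝ (fun t => (Q t).coeff k) t₀ := by
    intro k
    rcases lt_trichotomy k (n + 1) with hk | rfl | hk
    · simpa only [hQdef, monicOfFn_coeff_lt _ hk] using hb ⟨k, hk⟩
    · have : (fun t => (Q t).coeff (n + 1)) = fun _ => (1 : ℝ) := by
        funext t
        conv_lhs => rw [← hQd t]
        exact (hQm t).coeff_natDegree
      rw [this]
      exact analyticAt_const
    · have : (fun t => (Q t).coeff k) = fun _ => (0 : ℝ) := by
        funext t
        exact coeff_eq_zero_of_natDegree_lt (by rw [hQd]; exact hk)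
      rw [this]
      exact analyticAt_const
  have hscale : ∀ᶠ t in 𝓝 t₀, P t = (Q t).scaleRoots ((t - t₀) ^ r) := by
    filter_upwards [eventually_all.2 hPb] with t ht
    ext i
    rw [coeff_scaleRoots, hQd]
    rcases lt_trichotomy i (n + 1) with hi | rfl | hi
    · rw [ht ⟨i, hi⟩, hQdef, monicOfFn_coeff_lt _ hi, ← pow_mul, mul_comm]
    · have h1 := (hQm t).coeff_natDegree
      have h2 := (h.monic t).coeff_natDegree
      rw [hQd] at h1
      rw [h.natDegree_eq] at h2
      rw [h1, h2]
      simp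
    · rw [coeff_eq_zero_of_natDegree_lt (by rw [h.natDegree_eq]; exact hi),
        coeff_eq_zero_of_natDegree_lt (by rw [hQd]; exact hi), zero_mul]
  have hpunct : ∀ᶠ t in 𝓝[≠] t₀, (t - t₀) ^ r ≠ 0 ∧ (Q t).Splits ∧
      (P t).roots = (Q t).roots.map (fun x => (t - t₀) ^ r * x) := by
    filter_upwards [hscale.filter_mono nhdsWithin_le_nhds, h.splits.filter_mono nhdsWithin_le_nhds,
      self_mem_nhdsWithin] with t h1 h2 h3
    have hs : (t - t₀) ^ r ≠ 0 := pow_ne_zero _ (sub_ne_zero.2 h3)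
    have h4 : (Q t).Splits := by
      have := h2.scaleRoots ((t - t₀) ^ r)⁻¹
      rwa [h1, ← scaleRoots_mul, mul_inv_cancel₀ hs, scaleRoots_one] at this
    exact ⟨hs, h4, by rw [h1, roots_scaleRoots_of_splits (hQm t) h4]⟩
  -- For `r > 0` the scaling identity says nothing about `Q` at `t₀` itself, so real-rootedness
  -- there comes from a limit.
  have hQ0 : (Q t₀).Splits := by
    refine splits_of_eventually_splits hQm hQd (fun k => (hQa k).continuousAt) (B := C) ?_
    filter_upwards [hpunct, hroot.filter_mono nhdsWithin_le_nhds] with t ⟨h1, h2, h3⟩ h4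
    refine ⟨h2, fun z hz => ?_⟩
    have h5 := h4 ((t - t₀) ^ r * z) (by rw [h3]; exact Multiset.mem_map_of_mem _ hz)
    rw [abs_mul, abs_pow, mul_comm] at h5
    exact le_of_mul_le_mul_right h5 (by rw [← abs_pow]; exact abs_pos.2 h1)
  have hQs : ∀ᶠ t in 𝓝 t₀, (Q t).Splits := by
    rw [eventually_nhdsWithin_iff] at hpunct
    filter_upwards [hpunct] with t ht
    by_cases h1 : t = t₀
    · rw [h1]; exact hQ0
    · exact (ht h1).2.1
  have hQf : IsHyperbolicFamily (n + 1) Q t₀ := ⟨hQm, hQd, hQa, hQs⟩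
  refine ⟨Q, r, hQf, hscale, ?_, ?_⟩
  · rw [sum_roots_eq_neg_coeff (hQm t₀) (hQd t₀) hQ0, neg_eq_zero]
    have h1 : ∀ᶠ t in 𝓝[≠] t₀, (Q t).coeff n = 0 := by
      filter_upwards [hpunct, hsum.filter_mono nhdsWithin_le_nhds] with t ⟨h1, h2, h3⟩ h4
      rw [h3, Multiset.sum_map_mul_left, Multiset.map_id', mul_eq_zero] at h4
      rw [← neg_eq_zero, ← sum_roots_eq_neg_coeff (hQm t) (hQd t) h2]
      exact h4.resolve_left h1
    exact tendsto_nhds_unique_of_eventuallyEq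
      ((hQa n).continuousAt.tendsto.mono_left nhdsWithin_le_nhds) tendsto_const_nhds h1
  · obtain ⟨v, hv, hQv⟩ := hQf.exists_analytic_sum_sq
    rw [hQv t₀ hQ0]
    -- Off `t₀`, scaling multiplies the sum of squares by `(t - t₀)^(2r)`; cancelling it identifies
    -- the sum for `Q` with `g`, and `g t₀ ≠ 0`.
    have h1 : v =ᶠ[𝓝[≠] t₀] g := by
      filter_upwards [hpunct, h.splits.filter_mono nhdsWithin_le_nhds,
        hwg.filter_mono nhdsWithin_le_nhds] with t ⟨h1, h2, h3⟩ h4 h5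
      have h6 := hPw t h4
      rw [h3, sum_sq_map_mul, hQv t h2, h5, smul_eq_mul, ← two_mul, mul_comm 2 r, pow_mul] at h6
      exact mul_left_cancel₀ (pow_ne_zero 2 h1) h6
    have h2 : v t₀ = g t₀ := tendsto_nhds_unique_of_eventuallyEq
      (hv.continuousAt.tendsto.mono_left nhdsWithin_le_nhds)
      (hg.continuousAt.tendsto.mono_left nhdsWithin_le_nhds) h1
    rw [h2]
    exact hg0

/-- Rellich's theorem, local form: the roots of a hyperbolic family can be chosen analytically. -/
theorem IsHyperbolicFamily.exists_analytic_roots {N : ℕ} {P : ℝ → ℝ[X]} {t₀ : ℝ}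
    (h : IsHyperbolicFamily N P t₀) : ∃ F : Multiset (ℝ → ℝ), (∀ f ∈ F, AnalyticAt ℝ f t₀) ∧
      ∀ᶠ t in 𝓝 t₀, (P t).roots = F.map (fun f => f t) := by
  induction N using Nat.strong_induction_on generalizing P with
  | _ N ih =>
  match N, ih, h with
  | 0, _, h =>
    refine ⟨0, by simp, ?_⟩
    filter_upwards [h.splits] with t ht
    rw [Multiset.map_zero, ← Multiset.card_eq_zero, ← ht.natDegree_eq_card_roots, h.natDegree_eq]
  | n + 1, ih, h =>
  have hcentred : ∀ P : ℝ → ℝ[X], IsHyperbolicFamily (n + 1) P t₀ →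
      (∀ᶠ t in 𝓝 t₀, (P t).roots.sum = 0) →
      ∃ F : Multiset (ℝ → ℝ), (∀ f ∈ F, AnalyticAt ℝ f t₀) ∧
      ∀ᶠ t in 𝓝 t₀, (P t).roots = F.map (fun f => f t) := by
    intro P h hsum
    by_cases hzero : ∀ᶠ t in 𝓝 t₀, ((P t).roots.map (fun x => x ^ 2)).sum = 0
    · refine ⟨Multiset.replicate (n + 1) (fun _ => 0), fun f hf => ?_, ?_⟩
      · rw [Multiset.eq_of_mem_replicate hf]
        exact analyticAt_const
      · filter_upwards [hzero, h.splits] with t h1 h2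
        rw [Multiset.map_replicate, Multiset.eq_replicate, ← h2.natDegree_eq_card_roots,
          h.natDegree_eq]
        refine ⟨rfl, fun z hz => ?_⟩
        have := sq_le_sum_sq hz
        rw [h1] at this
        exact pow_eq_zero_iff (two_ne_zero) |>.1 (le_antisymm this (sq_nonneg z))
    obtain ⟨Q, r, hQ, hPQ, hQsum, hQsq⟩ := h.exists_scaleRoots hsum hzero
    obtain ⟨p, q, hp, hq, hpq, hQ0, hpN, hqN⟩ :=
      exists_coprime_factorization (hQ.monic t₀) (hQ.natDegree_eq t₀) hQsum hQsq
    obtain ⟨p', q', ⟨hp'm, hp'd, hp'a⟩, ⟨hq'm, hq'd, hq'a⟩, hfac⟩ :=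
      exists_analytic_factorization hQ.monic hQ.natDegree_eq hQ.analyticAt_coeff hp hq hpq hQ0
    have hp' : IsHyperbolicFamily p.natDegree p' t₀ := by
      refine ⟨hp'm, hp'd, hp'a, ?_⟩
      filter_upwards [hfac, hQ.splits] with t h1 h2
      exact h2.of_dvd (hQ.monic t).ne_zero (h1 ▸ dvd_mul_right _ _)
    have hq' : IsHyperbolicFamily q.natDegree q' t₀ := by
      refine ⟨hq'm, hq'd, hq'a, ?_⟩
      filter_upwards [hfac, hQ.splits] with t h1 h2
      exact h2.of_dvd (hQ.monic t).ne_zero (h1 ▸ dvd_mul_left _ _)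
    obtain ⟨F, hF, hpF⟩ := ih _ hpN hp'
    obtain ⟨G, hG, hqG⟩ := ih _ hqN hq'
    refine ⟨(F + G).map (fun f t => (t - t₀) ^ r * f t), fun f hf => ?_, ?_⟩
    · obtain ⟨k, hk, rfl⟩ := Multiset.mem_map.1 hf
      have hk' : AnalyticAt ℝ k t₀ := (Multiset.mem_add.1 hk).elim (hF k) (hG k)
      exact ((analyticAt_id.sub analyticAt_const).pow r).mul hk'
    · filter_upwards [hPQ, hfac, hpF, hqG, hQ.splits] with t h1 h2 h3 h4 h5
      rw [h1, roots_scaleRoots_of_splits (hQ.monic t) h5, h2,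
        roots_mul ((hp'm t).mul (hq'm t)).ne_zero, h3, h4, ← Multiset.map_add, Multiset.map_map,
        Multiset.map_map]
      rfl
  -- The mean of the roots; translating by it makes their sum zero.
  set c : ℝ → ℝ := fun t => -(P t).coeff n / (n + 1) with hc
  have hca : AnalyticAt ℝ c t₀ := ((h.analyticAt_coeff n).neg).div analyticAt_const (by positivity)
  obtain ⟨F, hF, hPF⟩ := hcentred _ (h.taylor hca) (by
    filter_upwards [h.splits] with t ht
    rw [roots_taylor_eq_map, Multiset.sum_map_sub, Multiset.map_id', Multiset.map_const',
      Multiset.sum_replicate, ← ht.natDegree_eq_card_roots, h.natDegree_eq,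
      sum_roots_eq_neg_coeff (h.monic t) (h.natDegree_eq t) ht, hc]
    simp only [nsmul_eq_mul, Nat.cast_add, Nat.cast_one]
    field_simp
    ring)
  refine ⟨F.map (fun f t => f t + c t), fun f hf => ?_, ?_⟩
  · obtain ⟨k, hk, rfl⟩ := Multiset.mem_map.1 hf
    exact (hF k hk).add hca
  · filter_upwards [hPF] with t ht
    rw [roots_taylor_eq_map] at ht
    rw [Multiset.map_map]
    have h1 := congrArg (Multiset.map fun x => x + c t) ht
    simpa [Multiset.map_map, Function.comp_def] using h1

end LocalAnalyticRoots

/-! ### Gluing local systems of analytic roots -/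

section GlobalAnalyticRoots

open Polynomial

/-- Since `G` is finite, a given `f` in `F` meets some `g` in `G` at points accumulating at `t₀`; by
the identity theorem they coincide near `t₀`. Remove the pair and repeat. -/
lemma rel_eventuallyEq_of_map_eq {F G : Multiset (ℝ → ℝ)} {t₀ : ℝ}
    (hF : ∀ f ∈ F, AnalyticAt ℝ f t₀) (hG : ∀ g ∈ G, AnalyticAt ℝ g t₀)
    (h : ∀ᶠ t in 𝓝 t₀, F.map (fun f => f t) = G.map (fun g => g t)) :
    Multiset.Rel (fun f g => f =ᶠ[𝓝 t₀] g) F G := by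
  induction F using Multiset.induction_on generalizing G with
  | empty =>
    have h0 := h.self_of_nhds
    rw [Multiset.map_zero, eq_comm, Multiset.map_eq_zero] at h0
    rw [h0]
    exact Multiset.Rel.zero
  | cons f F ih =>
    obtain ⟨g, hg, hfg⟩ : ∃ g ∈ G, ∃ᶠ t in 𝓝[≠] t₀, f t = g t := by
      by_contra! hcon
      have h1 : ∀ᶠ t in 𝓝[≠] t₀, ∀ g ∈ {g | g ∈ G}, ¬ f t = g t := by
        rw [eventually_all_finite (Multiset.finite_toSet G)]
        exact hcon
      obtain ⟨t, h1, h2⟩ := (h1.and (h.filter_mono nhdsWithin_le_nhds)).exists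
      have h3 : f t ∈ G.map (fun g => g t) := by
        rw [← h2]
        exact Multiset.mem_map_of_mem (fun f => f t) (Multiset.mem_cons_self f F)
      obtain ⟨g, hg, hgt⟩ := Multiset.mem_map.1 h3
      exact h1 g hg hgt.symm
    have hev : f =ᶠ[𝓝 t₀] g := ((hF f (Multiset.mem_cons_self f F)).frequently_eq_iff_eventually_eq
      (hG g hg)).1 hfg
    obtain ⟨G', rfl⟩ := Multiset.exists_cons_of_mem hg
    refine Multiset.Rel.cons hev (ih (fun k hk => hF k (Multiset.mem_cons_of_mem hk))
      (fun k hk => hG k (Multiset.mem_cons_of_mem hk)) ?_)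
    filter_upwards [h, hev] with t h1 h2
    rw [Multiset.map_cons, Multiset.map_cons, h2] at h1
    exact (Multiset.cons_inj_right _).1 h1

/-- `F` is a system of analytic functions on `(a, b)` parametrizing the roots of `P`. -/
def IsRootSystem (P : ℝ → ℝ[X]) (a b : ℝ) (F : Multiset (ℝ → ℝ)) : Prop :=
  (∀ f ∈ F, ∀ t ∈ Set.Ioo a b, AnalyticAt ℝ f t) ∧
    ∀ t ∈ Set.Ioo a b, (P t).roots = F.map (fun f => f t)

lemma analyticAt_ite_lt {f g : ℝ → ℝ} {a b c d m : ℝ} (hm : m ∈ Set.Ioo a b)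
    (hm' : m ∈ Set.Ioo c d) (hf : ∀ t ∈ Set.Ioo a b, AnalyticAt ℝ f t)
    (hg : ∀ t ∈ Set.Ioo c d, AnalyticAt ℝ g t) (hfg : f =ᶠ[𝓝 m] g) :
    ∀ t ∈ Set.Ioo a d, AnalyticAt ℝ (fun t => if t < m then f t else g t) t := by
  intro t ht
  rcases lt_trichotomy t m with h | rfl | h
  · refine (hf t ⟨ht.1, h.trans hm.2⟩).congr ?_
    filter_upwards [Iio_mem_nhds h] with s hs
    exact (if_pos hs).symm
  · refine (hg t hm').congr ?_
    filter_upwards [hfg] with s hs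
    rw [hs, ite_self]
  · refine (hg t ⟨hm'.1.trans h, ht.2⟩).congr ?_
    filter_upwards [Ioi_mem_nhds h] with s hs
    exact (if_neg (not_lt.2 (le_of_lt hs))).symm

lemma exists_glued_system {F G : Multiset (ℝ → ℝ)} {a b c d m : ℝ} (hm : m ∈ Set.Ioo a b)
    (hm' : m ∈ Set.Ioo c d) (hrel : Multiset.Rel (fun f g => f =ᶠ[𝓝 m] g) F G)
    (hF : ∀ f ∈ F, ∀ t ∈ Set.Ioo a b, AnalyticAt ℝ f t)
    (hG : ∀ g ∈ G, ∀ t ∈ Set.Ioo c d, AnalyticAt ℝ g t) :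
    ∃ H : Multiset (ℝ → ℝ), (∀ f ∈ H, ∀ t ∈ Set.Ioo a d, AnalyticAt ℝ f t) ∧
      (∀ t < m, H.map (fun f => f t) = F.map (fun f => f t)) ∧
      ∀ t, m ≤ t → H.map (fun f => f t) = G.map (fun f => f t) := by
  induction hrel with
  | zero => exact ⟨0, by simp, by simp, by simp⟩
  | @cons f g F G hfg _ ih =>
    obtain ⟨H, h1, h2, h3⟩ := ih (fun k hk => hF k (Multiset.mem_cons_of_mem hk))
      (fun k hk => hG k (Multiset.mem_cons_of_mem hk))
    refine ⟨(fun t => if t < m then f t else g t) ::ₘ H, fun k hk => ?_, fun t ht => ?_,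
      fun t ht => ?_⟩
    · rcases Multiset.mem_cons.1 hk with rfl | hk
      · exact analyticAt_ite_lt hm hm' (hF f (Multiset.mem_cons_self f F))
          (hG g (Multiset.mem_cons_self g G)) hfg
      · exact h1 k hk
    · rw [Multiset.map_cons, Multiset.map_cons, h2 t ht]
      exact congrArg (· ::ₘ _) (if_pos ht)
    · rw [Multiset.map_cons, Multiset.map_cons, h3 t ht]
      exact congrArg (· ::ₘ _) (if_neg (not_lt.2 ht))

lemma IsRootSystem.glue {P : ℝ → ℝ[X]} {F G : Multiset (ℝ → ℝ)} {a b c d m : ℝ}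
    (hF : IsRootSystem P a b F) (hG : IsRootSystem P c d G) (hm : m ∈ Set.Ioo a b)
    (hm' : m ∈ Set.Ioo c d) : ∃ H, IsRootSystem P a d H := by
  have hrel := rel_eventuallyEq_of_map_eq (fun f hf => hF.1 f hf m hm)
    (fun g hg => hG.1 g hg m hm') (by
      filter_upwards [Ioo_mem_nhds hm.1 hm.2, Ioo_mem_nhds hm'.1 hm'.2] with t h1 h2
      rw [← hF.2 t h1, ← hG.2 t h2])
  obtain ⟨H, h1, h2, h3⟩ := exists_glued_system hm hm' hrel hF.1 hG.1
  refine ⟨H, h1, fun t ht => ?_⟩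
  rcases lt_or_ge t m with h | h
  · rw [h2 t h, hF.2 t ⟨ht.1, h.trans hm.2⟩]
  · rw [h3 t h, hG.2 t ⟨hm'.1.trans_le h, ht.2⟩]

lemma IsHyperbolicFamily.exists_isRootSystem {N : ℕ} {P : ℝ → ℝ[X]} {t₀ : ℝ}
    (h : IsHyperbolicFamily N P t₀) : ∃ δ > 0, ∃ F, IsRootSystem P (t₀ - δ) (t₀ + δ) F := by
  obtain ⟨F, hF, hPF⟩ := h.exists_analytic_roots
  have h1 : ∀ᶠ t in 𝓝 t₀, ∀ f ∈ {f | f ∈ F}, AnalyticAt ℝ f t := by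
    rw [eventually_all_finite (Multiset.finite_toSet F)]
    exact fun f hf => (hF f hf).eventually_analyticAt
  obtain ⟨δ, hδ, hball⟩ := Metric.eventually_nhds_iff_ball.1 (h1.and hPF)
  rw [Real.ball_eq_Ioo] at hball
  exact ⟨δ, hδ, F, fun f hf t ht => (hball t ht).1 f hf, fun t ht => (hball t ht).2⟩

/-- Rellich's theorem on a neighbourhood of a compact interval. -/
theorem exists_isRootSystem_Icc {N : ℕ} {P : ℝ → ℝ[X]} (h : ∀ t, IsHyperbolicFamily N P t)
    {a b : ℝ} (hab : a ≤ b) : ∃ ε > 0, ∃ F, IsRootSystem P (a - ε) (b + ε) F := by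
  choose δ hδ F hF using fun t => (h t).exists_isRootSystem
  obtain ⟨t, ht0, htm, ⟨m, hm⟩, hsub⟩ := exists_monotone_Icc_subset_open_cover_Icc hab
    (c := fun x : ℝ => {s : Set.Icc a b | (s : ℝ) ∈ Set.Ioo (x - δ x) (x + δ x)})
    (fun x => isOpen_Ioo.preimage continuous_subtype_val)
    (fun s _ => Set.mem_iUnion.2 ⟨s, ⟨by linarith [hδ s], by linarith [hδ s]⟩⟩)
  -- The partition `t` is so fine that each closed step lies in one local interval. The system is
  -- extended step by step, gluing at `t n`.
  have key : ∀ n, ∃ ε > 0, ∃ F, IsRootSystem P (a - ε) (t n + ε) F := by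
    intro n
    induction n with
    | zero =>
      rw [ht0]
      exact ⟨δ a, hδ a, F a, hF a⟩
    | succ n ih =>
      obtain ⟨ε, hε, G, hG⟩ := ih
      obtain ⟨x, hx⟩ := hsub n
      have h1 := hx (Set.left_mem_Icc.2 (htm (Nat.le_succ n)))
      have h2 := hx (Set.right_mem_Icc.2 (htm (Nat.le_succ n)))
      simp only [Set.mem_ofPred_eq] at h1 h2
      obtain ⟨H, hH⟩ := hG.glue (hF x) (m := t n)
        ⟨by linarith [(t n).2.1], by linarith⟩ h1
      refine ⟨min ε (x + δ x - t (n + 1)), lt_min hε (by linarith [h2.2]), H, ?_⟩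
      have hs : Set.Ioo (a - min ε (x + δ x - t (n + 1)))
          (t (n + 1) + min ε (x + δ x - t (n + 1))) ⊆ Set.Ioo (a - ε) (x + δ x) := by
        refine Set.Ioo_subset_Ioo ?_ ?_
        · linarith [min_le_left ε (x + δ x - t (n + 1))]
        · linarith [min_le_right ε (x + δ x - t (n + 1))]
      exact ⟨fun f hf s hs' => hH.1 f hf s (hs hs'), fun s hs' => hH.2 s (hs hs')⟩
  have := key m
  rwa [hm m le_rfl] at this

end GlobalAnalyticRoots

/-! ### Analytic eigenvalues of Hermitian families -/

section AnalyticEigenvalues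

open Polynomial

variable {ι : Type*}

lemma analyticAt_coeff_prod {p : ι → ℝ → ℂ[X]} {t₀ : ℝ} (s : Finset ι)
    (h : ∀ i ∈ s, ∀ k, AnalyticAt ℝ (fun t => (p i t).coeff k) t₀) (k : ℕ) :
    AnalyticAt ℝ (fun t => (∏ i ∈ s, p i t).coeff k) t₀ := by
  classical
  induction s using Finset.induction_on generalizing k with
  | empty => simpa using analyticAt_const
  | insert i s hi ih =>
    simp only [Finset.prod_insert hi, coeff_mul]
    refine Finset.analyticAt_fun_sum _ fun x _ => ?_
    exact (h i (Finset.mem_insert_self i s) _).mul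
      (ih (fun j hj => h j (Finset.mem_insert_of_mem hj)) _)

lemma analyticAt_coeff_charpoly {N : ℕ} {M : ℝ → Matrix (Fin N) (Fin N) ℂ} {t₀ : ℝ}
    (h : ∀ i j, AnalyticAt ℝ (fun t => M t i j) t₀) (k : ℕ) :
    AnalyticAt ℝ (fun t => (M t).charpoly.coeff k) t₀ := by
  simp only [Matrix.charpoly, Matrix.det_apply, finsetSum_coeff, coeff_smul]
  refine Finset.analyticAt_fun_sum _ fun σ _ => ?_
  have h1 : AnalyticAt ℝ (fun t => (∏ i, (M t).charmatrix (σ i) i).coeff k) t₀ := by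
    refine analyticAt_coeff_prod _ (fun i _ l => ?_) k
    simp only [Matrix.charmatrix_apply, coeff_sub, coeff_C]
    refine analyticAt_const.sub ?_
    by_cases hl : l = 0
    · simpa [hl] using h _ _
    · simpa [hl] using analyticAt_const
  simp only [Units.smul_def, zsmul_eq_mul]
  exact analyticAt_const.mul h1

lemma exists_eq_univ_map {α : Type*} (s : Multiset α) {N : ℕ} (h : s.card = N) :
    ∃ f : Fin N → α, s = Finset.univ.val.map f := by
  obtain ⟨l, rfl⟩ := Quot.exists_rep s
  have hl : l.length = N := h
  subst hl
  refine ⟨l.get, ?_⟩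
  rw [Fin.univ_val_map, List.ofFn_get]
  rfl

/-- Rellich's theorem: the eigenvalues of an analytic family of Hermitian matrices are analytic on
a neighbourhood of each compact interval. -/
theorem exists_analytic_eigenvalues {N : ℕ} {M : ℝ → Matrix (Fin N) (Fin N) ℂ}
    (hM : ∀ t, (M t).IsHermitian) (h : ∀ t i j, AnalyticAt ℝ (fun t => M t i j) t) {a b : ℝ}
    (hab : a ≤ b) : ∃ ε > 0, ∃ ν : Fin N → ℝ → ℝ,
      (∀ j, ∀ t ∈ Set.Ioo (a - ε) (b + ε), AnalyticAt ℝ (ν j) t) ∧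
      ∀ t ∈ Set.Ioo (a - ε) (b + ε), (M t).charpoly = ∏ j, (X - C ((ν j t : ℝ) : ℂ)) := by
  set P : ℝ → ℝ[X] := fun t => ∏ j, (X - C ((hM t).eigenvalues j)) with hP
  have hmap : ∀ t, (P t).map Complex.ofRealHom = (M t).charpoly := by
    intro t
    rw [(hM t).charpoly_eq, hP, Polynomial.map_prod]
    simp
  have hroots : ∀ t, (P t).roots = Finset.univ.val.map (hM t).eigenvalues := by
    intro t
    rw [hP]
    have := roots_multiset_prod_X_sub_C (Finset.univ.val.map (hM t).eigenvalues)
    rw [Multiset.map_map] at this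
    exact this
  have hPf : ∀ t, IsHyperbolicFamily N P t := by
    intro t
    refine ⟨fun t => monic_prod_of_monic _ _ fun j _ => monic_X_sub_C _, fun t => ?_, fun k => ?_,
      Eventually.of_forall fun t => Splits.prod fun j _ => Splits.X_sub_C _⟩
    · rw [hP, natDegree_prod_of_monic _ _ fun j _ => monic_X_sub_C _]
      simp
    -- The eigenvalues in `P` are not known to be analytic, but its coefficients are real parts of
    -- polynomials in the entries of `M`.
    · have h1 : (fun t => (P t).coeff k) = fun t => Complex.reCLM ((M t).charpoly.coeff k) := by
        funext t
        rw [← hmap t, coeff_map]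
        simp
      rw [h1]
      exact (Complex.reCLM.analyticAt _).comp (analyticAt_coeff_charpoly (h t) k)
  obtain ⟨ε, hε, F, hF⟩ := exists_isRootSystem_Icc hPf hab
  have ha : a ∈ Set.Ioo (a - ε) (b + ε) := ⟨by linarith, by linarith⟩
  have hcard : F.card = N := by
    have := congrArg Multiset.card (hF.2 a ha)
    rw [hroots, Multiset.card_map, Multiset.card_map] at this
    simpa using this.symm
  obtain ⟨ν, rfl⟩ := exists_eq_univ_map F hcard
  refine ⟨ε, hε, ν, fun j t ht => hF.1 _ (Multiset.mem_map_of_mem _ (Finset.mem_univ j)) t ht,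
    fun t ht => ?_⟩
  have h2 := hF.2 t ht
  rw [hroots, Multiset.map_map] at h2
  rw [(hM t).charpoly_eq]
  have h3 := congrArg (fun s : Multiset ℝ => (s.map fun x : ℝ => (X - C (x : ℂ))).prod) h2
  simp only [Multiset.map_map] at h3
  exact h3

end AnalyticEigenvalues

/-! ### Signs of an analytic function on either side of its zeros -/

section CurveSigns

/-- By Taylor's formula `g(x₀) = f^(m)(x₀) / m!`, which has the sign of the leading derivative. -/
lemma exists_leading_factor {f : ℝ → ℝ} {x₀ : ℝ} (hf : AnalyticAt ℝ f x₀)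
    (h : analyticOrderAt f x₀ ≠ ⊤) : leadingDeriv f x₀ ≠ 0 ∧ ∃ g : ℝ → ℝ, ContinuousAt g x₀ ∧
      SignType.sign (g x₀) = SignType.sign (leadingDeriv f x₀) ∧
      ∀ᶠ x in 𝓝 x₀, f x = (x - x₀) ^ vanishingOrder f x₀ * g x := by
  set m := vanishingOrder f x₀ with hm
  have hord : analyticOrderAt f x₀ = m := (Nat.cast_analyticOrderNatAt h).symm
  obtain ⟨hlow, hlead⟩ := (analyticOrderAt_eq_nat_iff_iteratedDeriv_eq_zero hf).1 hord
  refine ⟨hlead, ?_⟩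
  set D := iteratedDeriv m f x₀ with hD
  have hshift : AnalyticAt ℝ (fun z => f (x₀ + z)) 0 := by
    refine AnalyticAt.fun_comp (g := f) (f := fun z => x₀ + z) (by simpa using hf) ?_
    fun_prop
  have hder : ∀ i, iteratedDeriv i (fun z => f (x₀ + z)) 0 = iteratedDeriv i f x₀ := by
    intro i
    rw [iteratedDeriv_comp_const_add]
    simp
  obtain ⟨F, hF, hfF⟩ := hshift.exists_eq_sum_add_pow_mul (m + 1)
  refine ⟨fun x => D / m.factorial + (x - x₀) * F (x - x₀), ?_, ?_, Eventually.of_forall fun x => ?_⟩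
  · have h1 : ContinuousAt (fun x => F (x - x₀)) x₀ :=
      ContinuousAt.comp (g := F) (f := fun x => x - x₀) (by simpa using hF.continuousAt)
        (by fun_prop)
    exact continuousAt_const.add ((continuousAt_id.sub continuousAt_const).mul h1)
  · have hfac : (0 : ℝ) < m.factorial := by positivity
    change SignType.sign _ = SignType.sign D
    simp only [sub_self, zero_mul, add_zero, div_eq_mul_inv, sign_mul, sign_pos (inv_pos.2 hfac),
      mul_one]
  · have h1 := hfF (x - x₀)
    simp only [hder, add_sub_cancel, smul_eq_mul] at h1
    rw [Finset.sum_range_succ, Finset.sum_eq_zero fun i hi => by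
      rw [hlow i (Finset.mem_range.1 hi), mul_zero]] at h1
    rw [h1]
    ring

/-- The signs of a curve on both sides of a point. -/
lemma eventually_sign_eq {f : ℝ → ℝ} {x₀ : ℝ} (hf : AnalyticAt ℝ f x₀)
    (h : analyticOrderAt f x₀ ≠ ⊤) :
    (∀ᶠ x in 𝓝[>] x₀, SignType.sign (f x) = SignType.sign (leadingDeriv f x₀)) ∧
      ∀ᶠ x in 𝓝[<] x₀, SignType.sign (f x) =
        (-1) ^ vanishingOrder f x₀ * SignType.sign (leadingDeriv f x₀) := by
  obtain ⟨hlead, g, hg, hgs, hfg⟩ := exists_leading_factor hf h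
  have hg0 : g x₀ ≠ 0 := by
    rw [← sign_ne_zero, hgs, sign_ne_zero]; exact hlead
  have hgx : ∀ᶠ x in 𝓝 x₀, SignType.sign (g x) = SignType.sign (leadingDeriv f x₀) := by
    rw [← hgs]
    rcases hg0.lt_or_gt with h0 | h0
    · filter_upwards [hg.eventually (gt_mem_nhds h0)] with x hx
      rw [sign_neg hx, sign_neg h0]
    · filter_upwards [hg.eventually (lt_mem_nhds h0)] with x hx
      rw [sign_pos hx, sign_pos h0]
  constructor
  · filter_upwards [hfg.filter_mono nhdsWithin_le_nhds, hgx.filter_mono nhdsWithin_le_nhds,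
      self_mem_nhdsWithin] with x h1 h2 h3
    rw [h1, sign_mul, h2, sign_pow, sign_pos (sub_pos.2 h3), one_pow, one_mul]
  · filter_upwards [hfg.filter_mono nhdsWithin_le_nhds, hgx.filter_mono nhdsWithin_le_nhds,
      self_mem_nhdsWithin] with x h1 h2 h3
    rw [h1, sign_mul, h2, sign_pow, sign_neg (sub_neg.2 h3)]

/-- Half the jump of the sign of a curve at a point. -/
noncomputable def signJump (f : ℝ → ℝ) (x₀ : ℝ) : ℤ :=
  if Even (vanishingOrder f x₀) then 0 else (SignType.sign (leadingDeriv f x₀) : ℤ)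

/-- This form separates the order, which counts roots, from the jump, which changes the signature.
-/
lemma curveKreinPos_eq (f : ℝ → ℝ) (x₀ : ℝ) :
    curveKreinPos f x₀ = ((vanishingOrder f x₀ : ℚ) + (signJump f x₀ : ℚ)) / 2 := by
  unfold curveKreinPos signJump
  split_ifs <;> simp

lemma curveKreinNeg_eq (f : ℝ → ℝ) (x₀ : ℝ) :
    curveKreinNeg f x₀ = ((vanishingOrder f x₀ : ℚ) - (signJump f x₀ : ℚ)) / 2 := by
  unfold curveKreinNeg signJump
  split_ifs <;> simp

lemma vanishingOrder_eq_zero {f : ℝ → ℝ} {x₀ : ℝ} (h : f x₀ ≠ 0) : vanishingOrder f x₀ = 0 := by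
  by_contra h0
  exact h (apply_eq_zero_of_analyticOrderNatAt_ne_zero h0)

lemma signJump_eq_zero {f : ℝ → ℝ} {x₀ : ℝ} (h : f x₀ ≠ 0) : signJump f x₀ = 0 := by
  simp [signJump, vanishingOrder_eq_zero h]

lemma sign_eq_sign_of_forall_ne_zero {f : ℝ → ℝ} (hf : Continuous f) {a b : ℝ} (hab : a ≤ b)
    (h : ∀ x ∈ Set.Icc a b, f x ≠ 0) : SignType.sign (f a) = SignType.sign (f b) := by
  have ha := h a (Set.left_mem_Icc.2 hab)
  have hb := h b (Set.right_mem_Icc.2 hab)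
  rcases ha.lt_or_gt with h1 | h1 <;> rcases hb.lt_or_gt with h2 | h2
  · rw [sign_neg h1, sign_neg h2]
  · obtain ⟨x, hx, hx0⟩ := intermediate_value_Icc hab hf.continuousOn ⟨h1.le, h2.le⟩
    exact absurd hx0 (h x hx)
  · obtain ⟨x, hx, hx0⟩ := intermediate_value_Icc' hab hf.continuousOn ⟨h2.le, h1.le⟩
    exact absurd hx0 (h x hx)
  · rw [sign_pos h1, sign_pos h2]

/-- The change of sign of an analytic function is the sum of its jumps. -/
theorem sign_sub_sign_eq_sum_signJump {f : ℝ → ℝ} (hf : ∀ x, AnalyticAt ℝ f x)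
    (hord : ∀ x, analyticOrderAt f x ≠ ⊤) {a : ℝ} (ha : f a ≠ 0) (Z : Finset ℝ) :
    ∀ b, a < b → f b ≠ 0 → (∀ x ∈ Z, x ∈ Set.Ioo a b) →
      (∀ x ∈ Set.Ioo a b, f x = 0 → x ∈ Z) →
      (SignType.sign (f b) : ℤ) - SignType.sign (f a) = 2 * ∑ x ∈ Z, signJump f x := by
  have hcont : Continuous f := continuous_iff_continuousAt.2 fun x => (hf x).continuousAt
  induction Z using Finset.induction_on_max with
  | empty =>
    intro b hab hb _ hz
    rw [sign_eq_sign_of_forall_ne_zero hcont hab.le fun x hx hx0 => ?_]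
    · simp
    · rcases hx.1.eq_or_lt with rfl | h1
      · exact ha hx0
      rcases hx.2.eq_or_lt with rfl | h2
      · exact hb hx0
      exact absurd (hz x ⟨h1, h2⟩ hx0) (Finset.notMem_empty x)
  | insert x₀ Z hmax ih =>
    intro b hab hb hZ hz
    have hx₀ := hZ x₀ (Finset.mem_insert_self _ _)
    obtain ⟨hr, hl⟩ := eventually_sign_eq (hf x₀) (hord x₀)
    have hlead := (exists_leading_factor (hf x₀) (hord x₀)).1
    have hZl : ∀ᶠ x in 𝓝[<] x₀, ∀ y ∈ Z, y < x :=
      ((Filter.eventually_all_finset Z).2 fun y hy => lt_mem_nhds (hmax y hy)).filter_mono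
        nhdsWithin_le_nhds
    -- The point `c` lies between the other zeros and the largest zero `x₀`, so induction covers
    -- `(a, c)`; `d` lies just to the right of `x₀`.
    obtain ⟨c, hcs, hcZ, hca, hcx⟩ := (hl.and (hZl.and
      (((lt_mem_nhds hx₀.1).filter_mono nhdsWithin_le_nhds).and self_mem_nhdsWithin))).exists
    obtain ⟨d, hds, hdb, hdx⟩ := (hr.and
      (((gt_mem_nhds hx₀.2).filter_mono nhdsWithin_le_nhds).and self_mem_nhdsWithin)).exists
    have hc0 : f c ≠ 0 := by
      rw [← sign_ne_zero, hcs]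
      exact mul_ne_zero (pow_ne_zero _ (by decide)) (sign_ne_zero.2 hlead)
    have hbd : SignType.sign (f d) = SignType.sign (f b) := by
      refine sign_eq_sign_of_forall_ne_zero hcont hdb.le fun x hx hx0 => ?_
      rcases hx.2.eq_or_lt with rfl | h2
      · exact hb hx0
      rcases Finset.mem_insert.1 (hz x ⟨by linarith [hx.1, hx₀.1], h2⟩ hx0) with rfl | h3
      · linarith [hx.1]
      · linarith [hmax x h3, hx.1]
    have hih := ih c hca hc0 (fun x hx => ⟨(hZ x (Finset.mem_insert_of_mem hx)).1, hcZ x hx⟩)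
      (fun x hx hx0 => by
        rcases Finset.mem_insert.1 (hz x ⟨hx.1, by linarith [hx.2, hx₀.2]⟩ hx0) with rfl | h3
        · linarith [hx.2]
        · exact h3)
    have hjump : (SignType.sign (f d) : ℤ) - SignType.sign (f c) = 2 * signJump f x₀ := by
      rw [hds, hcs, signJump]
      split_ifs with he
      · rw [he.neg_one_pow]; simp
      · rw [(Nat.not_even_iff_odd.1 he).neg_one_pow]
        generalize SignType.sign (leadingDeriv f x₀) = s
        cases s <;> decide
    rw [Finset.sum_insert fun hx => (hmax x₀ hx).false, mul_add, ← hjump, ← hih, hbd]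
    ring

end CurveSigns

/-! ### Signature and scaling -/

section Signature

open Polynomial

variable {N : ℕ}

lemma charpoly_smul_eq_scaleRoots (A : Matrix (Fin N) (Fin N) ℂ) {c : ℂ} (hc : c ≠ 0) :
    (c • A).charpoly = A.charpoly.scaleRoots c := by
  refine Polynomial.funext fun z => ?_
  obtain ⟨w, rfl⟩ : ∃ w, z = c * w := ⟨c⁻¹ * z, by field_simp⟩
  rw [scaleRoots_eval_mul, Matrix.eval_charpoly, Matrix.eval_charpoly,
    Matrix.charpoly_natDegree_eq_dim, Fintype.card_fin]
  have h : Matrix.scalar (Fin N) (c * w) - c • A = c • (Matrix.scalar (Fin N) w - A) := by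
    rw [smul_sub]
    congr 1
    ext i j
    simp [Matrix.scalar_apply, Matrix.diagonal_apply]
  rw [h, Matrix.det_smul, Fintype.card_fin]

lemma roots_charpoly_smul (A : Matrix (Fin N) (Fin N) ℂ) {c : ℂ} (hc : c ≠ 0) :
    (c • A).charpoly.roots = A.charpoly.roots.map (fun z => c * z) := by
  rw [charpoly_smul_eq_scaleRoots A hc, roots_scaleRoots _ hc.isUnit]

lemma charpoly_eq_prod_roots (A : Matrix (Fin N) (Fin N) ℂ) :
    A.charpoly = (A.charpoly.roots.map (fun z => X - C z)).prod :=
  (IsAlgClosed.splits _).eq_prod_roots_of_monic A.charpoly_monic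

lemma roots_prod_X_sub_C (a : Fin N → ℂ) :
    (∏ j, (X - C (a j))).roots = Finset.univ.val.map a := by
  have := roots_multiset_prod_X_sub_C (Finset.univ.val.map a)
  rw [Multiset.map_map] at this
  exact this

lemma charpoly_smul_eq_prod {A : Matrix (Fin N) (Fin N) ℂ} {a : Fin N → ℂ}
    (h : A.charpoly = ∏ j, (X - C (a j))) {c : ℂ} (hc : c ≠ 0) :
    (c • A).charpoly = ∏ j, (X - C (c * a j)) := by
  rw [charpoly_eq_prod_roots, roots_charpoly_smul A hc, h, roots_prod_X_sub_C, Multiset.map_map,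
    Multiset.map_map]
  rfl

/-- The signature of a Hermitian matrix: the sum of the signs of its eigenvalues. -/
noncomputable def signature (A : Matrix (Fin N) (Fin N) ℂ) : ℤ :=
  (A.charpoly.roots.map fun z => (SignType.sign z.re : ℤ)).sum

lemma signature_eq_sum {A : Matrix (Fin N) (Fin N) ℂ} {a : Fin N → ℝ}
    (h : A.charpoly = ∏ j, (X - C ((a j : ℝ) : ℂ))) :
    signature A = ∑ j, (SignType.sign (a j) : ℤ) := by
  rw [signature, h, roots_prod_X_sub_C, Multiset.map_map]
  rfl

lemma signature_smul (A : Matrix (Fin N) (Fin N) ℂ) {c : ℝ} (hc : c ≠ 0) :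
    signature ((c : ℂ) • A) = SignType.sign c * signature A := by
  rw [signature, roots_charpoly_smul A (by exact_mod_cast hc), Multiset.map_map, signature,
    ← Multiset.sum_map_mul_left]
  refine congrArg Multiset.sum (Multiset.map_congr rfl fun z _ => ?_)
  simp [sign_mul]

lemma charpoly_map_conj (A : Matrix (Fin N) (Fin N) ℂ) :
    (A.map (starRingEnd ℂ)).charpoly = A.conjTranspose.charpoly := by
  rw [← Matrix.charpoly_transpose A.conjTranspose]
  rfl

end Signature

/-! ### Reflection symmetry from the real structure -/

section RealStructure

variable {N : ℕ}

/-- A conjugate-linear map is `u ↦ U ū`, where the columns of `U` are the images of the basis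
vectors. -/
lemma exists_conjugation_matrix (I : EuclideanSpace ℂ (Fin N) →ₗᵢ⋆[ℂ] EuclideanSpace ℂ (Fin N))
    (hI : Function.Involutive I) : ∃ U : Matrix (Fin N) (Fin N) ℂ,
      U * U.map (starRingEnd ℂ) = 1 ∧
      ∀ A, IsRealWrt I A → A * U = U * A.map (starRingEnd ℂ) := by
  let U : Matrix (Fin N) (Fin N) ℂ := fun i j => I (EuclideanSpace.single j 1) i
  have hU : ∀ (u : EuclideanSpace ℂ (Fin N)) (i : Fin N),
      I u i = ∑ j, U i j * starRingEnd ℂ (u j) := by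
    intro u i
    have h1 : u = ∑ j, u j • EuclideanSpace.single j (1 : ℂ) := by
      ext k
      simp [Pi.single_apply]
    conv_lhs => rw [h1]
    rw [map_sum]
    simp only [map_smulₛₗ, PiLp.smul_apply, WithLp.ofLp_sum, Finset.sum_apply, smul_eq_mul, U]
    exact Finset.sum_congr rfl fun j _ => mul_comm _ _
  refine ⟨U, ?_, fun A hA => ?_⟩
  · ext i j
    have h1 := hU (I (EuclideanSpace.single j 1)) i
    rw [hI] at h1
    rw [Matrix.mul_apply]
    simp only [Matrix.map_apply]
    rw [← h1, Matrix.one_apply]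
    simp [PiLp.single_apply]
  · ext i j
    have h1 := congrArg (fun v : EuclideanSpace ℂ (Fin N) => v i) (hA (EuclideanSpace.single j 1))
    simp only [hU (Matrix.toEuclideanLin A (EuclideanSpace.single j 1)) i] at h1
    rw [Matrix.mul_apply, Matrix.mul_apply]
    simpa [Matrix.toLpLin_apply, Matrix.mulVec, dotProduct, U, PiLp.single_apply] using h1

variable {L J : Matrix (Fin N) (Fin N) ℂ}

lemma isHermitian_I_smul (hJ : J.conjTranspose = -J) : (Complex.I • J).IsHermitian := by
  rw [Matrix.IsHermitian, Matrix.conjTranspose_smul, hJ]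
  simp

lemma isHermitian_pencil (hL : L.IsHermitian) (hJ : J.conjTranspose = -J) (x : ℝ) :
    (pencil L J (x : ℂ)).IsHermitian := by
  refine hL.sub ?_
  rw [Matrix.IsHermitian, Matrix.conjTranspose_smul, (isHermitian_I_smul hJ).inv]
  simp

lemma isUnit_I_smul (hJu : IsUnit J) : IsUnit (Complex.I • J) := by
  rw [Matrix.isUnit_iff_isUnit_det, Matrix.det_smul]
  exact ((Complex.I_ne_zero.isUnit).pow _).mul ((Matrix.isUnit_iff_isUnit_det J).1 hJu)

/-- The spectrum of the pencil is symmetric with respect to reflection of the parameter. -/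
theorem charpoly_pencil_neg (hL : L.IsHermitian) (hJ : J.conjTranspose = -J) (hJu : IsUnit J)
    (I : EuclideanSpace ℂ (Fin N) →ₗᵢ⋆[ℂ] EuclideanSpace ℂ (Fin N))
    (hI : Function.Involutive I) (hLI : IsRealWrt I L) (hJI : IsRealWrt I J) (x : ℝ) :
    (pencil L J ((-x : ℝ) : ℂ)).charpoly = (pencil L J (x : ℂ)).charpoly := by
  obtain ⟨U, hU, hreal⟩ := exists_conjugation_matrix I hI
  set conj := starRingEnd ℂ
  set B := Complex.I • J with hB
  have hBu : IsUnit B.det := (Matrix.isUnit_iff_isUnit_det B).1 (isUnit_I_smul hJu)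
  have hKh : (B⁻¹).IsHermitian := (isHermitian_I_smul hJ).inv
  -- The minus sign comes from conjugating the factor `i`; it passes to `K = B⁻¹` and reverses `x`
  -- in the pencil.
  have hBU : B * U = -(U * B.map conj) := by
    have h1 : B.map conj = -(Complex.I • J.map conj) := by
      ext i j
      simp [hB, conj]
    rw [h1, hB, Matrix.smul_mul, hreal J hJI, Matrix.mul_neg, neg_neg, Matrix.mul_smul]
  have hKB : (B⁻¹).map conj * B.map conj = 1 := by
    rw [← Matrix.map_mul, Matrix.nonsing_inv_mul B hBu, Matrix.map_one _ (map_zero _) (map_one _)]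
  have hBK : B.map conj * (B⁻¹).map conj = 1 := mul_eq_one_comm.1 hKB
  have hKU : B⁻¹ * U = -(U * (B⁻¹).map conj) := by
    have h1 : B⁻¹ * (B * U) * (B⁻¹).map conj = B⁻¹ * (-(U * B.map conj)) * (B⁻¹).map conj := by
      rw [hBU]
    rw [← Matrix.mul_assoc, Matrix.nonsing_inv_mul B hBu, Matrix.one_mul, Matrix.mul_neg,
      Matrix.neg_mul, ← Matrix.mul_assoc, Matrix.mul_assoc (B⁻¹ * U), hBK, Matrix.mul_one] at h1
    rw [h1, neg_neg]
  have hpU : pencil L J (x : ℂ) * U = U * (pencil L J ((-x : ℝ) : ℂ)).map conj := by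
    have h1 : (pencil L J ((-x : ℝ) : ℂ)).map conj = L.map conj + (x : ℂ) • (B⁻¹).map conj := by
      ext i j
      simp [pencil, hB, conj]
    rw [h1, pencil, ← hB, Matrix.sub_mul, Matrix.smul_mul, hKU, hreal L hLI, Matrix.mul_add,
      Matrix.mul_smul]
    simp
  -- This is a similarity, since `U.map conj` inverts `U`. Entrywise conjugation does not change the
  -- characteristic polynomial of a Hermitian matrix.
  have hpx : pencil L J (x : ℂ) = U * ((pencil L J ((-x : ℝ) : ℂ)).map conj * U.map conj) := by
    rw [← Matrix.mul_assoc, ← hpU, Matrix.mul_assoc, hU, Matrix.mul_one]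
  rw [hpx, Matrix.charpoly_mul_comm, Matrix.mul_assoc, mul_eq_one_comm.1 hU, Matrix.mul_one,
    charpoly_map_conj, (isHermitian_pencil hL hJ (-x)).eq]

end RealStructure

/-! ### Existence of the eigenvalue curves and signature at infinity -/

section Curves

open Polynomial
open scoped ContDiff

variable {N : ℕ} {L J : Matrix (Fin N) (Fin N) ℂ}

lemma isHermitian_ofReal_smul {A : Matrix (Fin N) (Fin N) ℂ} (hA : A.IsHermitian) (r : ℝ) :
    ((r : ℂ) • A).IsHermitian := by
  rw [Matrix.IsHermitian, Matrix.conjTranspose_smul, hA.eq, Complex.star_def, Complex.conj_ofReal]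

/-- Rellich's theorem for the pencil: the eigenvalue curves exist. -/
theorem exists_isEigenvalueCurves (hL : L.IsHermitian) (hJ : J.conjTranspose = -J) :
    ∃ μ : Fin N → ℝ → ℝ, IsEigenvalueCurves L J μ := by
  set K := (Complex.I • J)⁻¹ with hK
  have hKh : K.IsHermitian := (isHermitian_I_smul hJ).inv
  -- With `x = tan θ` one has `𝓛(x) = √(1 + x²) M(θ)`, so the whole line is reached from `(-π/2,
  -- π/2) ⊆ [-2, 2]`, and Rellich's theorem near a compact interval suffices.
  set M : ℝ → Matrix (Fin N) (Fin N) ℂ := fun θ =>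
    ((Real.cos θ : ℝ) : ℂ) • L - ((Real.sin θ : ℝ) : ℂ) • K with hM
  have hMh : ∀ θ, (M θ).IsHermitian := by
    intro θ
    exact (isHermitian_ofReal_smul hL _).sub (isHermitian_ofReal_smul hKh _)
  have hMa : ∀ θ i j, AnalyticAt ℝ (fun t => M t i j) θ := by
    intro θ i j
    simp only [hM, Matrix.sub_apply, Matrix.smul_apply, smul_eq_mul]
    have h1 : AnalyticAt ℝ (fun t : ℝ => ((Real.cos t : ℝ) : ℂ)) θ :=
      (Complex.ofRealCLM.analyticAt _).comp Real.contDiff_cos.contDiffAt.analyticAt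
    have h2 : AnalyticAt ℝ (fun t : ℝ => ((Real.sin t : ℝ) : ℂ)) θ :=
      (Complex.ofRealCLM.analyticAt _).comp Real.contDiff_sin.contDiffAt.analyticAt
    exact (h1.mul analyticAt_const).sub (h2.mul analyticAt_const)
  obtain ⟨ε, hε, ν, hν, hchar⟩ := exists_analytic_eigenvalues hMh hMa
    (show (-2 : ℝ) ≤ 2 by norm_num)
  have hmem : ∀ x, Real.arctan x ∈ Set.Ioo (-2 - ε) (2 + ε) := fun x =>
    ⟨by linarith [Real.neg_pi_div_two_lt_arctan x, Real.pi_lt_four],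
      by linarith [Real.arctan_lt_pi_div_two x, Real.pi_lt_four]⟩
  refine ⟨fun j x => Real.sqrt (1 + x ^ 2) * ν j (Real.arctan x), fun j x => ?_, fun x => ?_⟩
  · have h1 : ContDiffAt ℝ ω (fun x : ℝ => Real.sqrt (1 + x ^ 2)) x :=
      ContDiffAt.sqrt (by fun_prop) (by positivity)
    have h2 : AnalyticAt ℝ Real.arctan x := Real.contDiff_arctan.contDiffAt.analyticAt
    exact h1.analyticAt.mul ((hν j _ (hmem x)).comp h2)
  · have hs : 0 < Real.sqrt (1 + x ^ 2) := Real.sqrt_pos.2 (by positivity)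
    have hpM : pencil L J (x : ℂ) = ((Real.sqrt (1 + x ^ 2) : ℝ) : ℂ) • M (Real.arctan x) := by
      rw [hM, pencil, ← hK]
      simp only [Real.cos_arctan, Real.sin_arctan, smul_sub, smul_smul, ← Complex.ofReal_mul]
      rw [mul_one_div_cancel hs.ne', mul_div_cancel₀ _ hs.ne', Complex.ofReal_one, one_smul]
    rw [hpM, charpoly_smul_eq_prod (hchar _ (hmem x)) (by exact_mod_cast hs.ne')]
    simp only [Complex.ofReal_mul]

lemma det_pencil_eq_prod {μ : Fin N → ℝ → ℝ} (hμ : IsEigenvalueCurves L J μ) (x : ℝ) :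
    (pencil L J (x : ℂ)).det = ((∏ j, μ j x : ℝ) : ℂ) := by
  rw [Matrix.det_eq_prod_roots_charpoly, hμ.charpoly_eq, roots_prod_X_sub_C]
  push_cast
  rfl

/-- The pencil has signature zero for large values of the parameter. -/
theorem eventually_signature_pencil_eq_zero (hL : L.IsHermitian) (hJ : J.conjTranspose = -J)
    (hJu : IsUnit J)
    (hsymm : ∀ x : ℝ, (pencil L J ((-x : ℝ) : ℂ)).charpoly = (pencil L J (x : ℂ)).charpoly) :
    ∀ᶠ x : ℝ in atTop, signature (pencil L J (x : ℂ)) = 0 := by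
  set K := (Complex.I • J)⁻¹ with hK
  have hKh : K.IsHermitian := (isHermitian_I_smul hJ).inv
  -- For `t ≠ 0`, `M(t) = t 𝓛(1/t)`. As `M(0) = -K` is invertible, the signature is constant near `t
  -- = 0`.
  set M : ℝ → Matrix (Fin N) (Fin N) ℂ := fun t => (t : ℂ) • L - K with hM
  have hMh : ∀ t, (M t).IsHermitian := by
    intro t
    exact (isHermitian_ofReal_smul hL t).sub hKh
  have hMa : ∀ t i j, AnalyticAt ℝ (fun t => M t i j) t := by
    intro t i j
    simp only [hM, Matrix.sub_apply, Matrix.smul_apply, smul_eq_mul]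
    exact ((Complex.ofRealCLM.analyticAt t).mul analyticAt_const).sub analyticAt_const
  obtain ⟨ε, hε, ν, hν, hchar⟩ := exists_analytic_eigenvalues hMh hMa (le_refl (0 : ℝ))
  simp only [zero_sub, zero_add] at hν hchar
  have hmem : (0 : ℝ) ∈ Set.Ioo (-ε) ε := ⟨by linarith, hε⟩
  have hne : ∀ j, ν j 0 ≠ 0 := by
    have h1 : (M 0).det ≠ 0 := by
      have h2 : M 0 = -K := by simp [hM]
      rw [h2, Matrix.det_neg, hK, Matrix.det_nonsing_inv]
      refine mul_ne_zero (pow_ne_zero _ (by simp)) ?_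
      rw [Ring.inverse_eq_inv']
      exact inv_ne_zero ((Matrix.isUnit_iff_isUnit_det _).1 (isUnit_I_smul hJu)).ne_zero
    rw [Matrix.det_eq_prod_roots_charpoly, hchar 0 hmem, roots_prod_X_sub_C] at h1
    intro j hj
    apply h1
    refine Multiset.prod_eq_zero (Multiset.mem_map.2 ⟨j, Finset.mem_univ j, ?_⟩)
    simp [hj]
  have hsig : ∀ᶠ t in 𝓝 (0 : ℝ), signature (M t) = signature (M 0) := by
    have h1 : ∀ᶠ t in 𝓝 (0 : ℝ), ∀ j, SignType.sign (ν j t) = SignType.sign (ν j 0) := by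
      refine eventually_all.2 fun j => ?_
      have hc := (hν j 0 hmem).continuousAt
      rcases (hne j).lt_or_gt with h0 | h0
      · filter_upwards [hc.eventually (gt_mem_nhds h0)] with x hx
        rw [sign_neg hx, sign_neg h0]
      · filter_upwards [hc.eventually (lt_mem_nhds h0)] with x hx
        rw [sign_pos hx, sign_pos h0]
    filter_upwards [h1, Ioo_mem_nhds hmem.1 hmem.2] with t h2 h3
    rw [signature_eq_sum (hchar t h3), signature_eq_sum (hchar 0 hmem)]
    exact Finset.sum_congr rfl fun j _ => by rw [h2 j]
  have hneg : Tendsto (fun t : ℝ => -t) (𝓝 0) (𝓝 0) := by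
    simpa using (continuous_neg (G := ℝ)).tendsto 0
  filter_upwards [tendsto_inv_atTop_zero.eventually (hsig.and (hneg.eventually hsig)),
    eventually_gt_atTop 0] with x ⟨h1, h2⟩ hx
  have hx' : x⁻¹ ≠ 0 := inv_ne_zero hx.ne'
  have e1 : M x⁻¹ = ((x⁻¹ : ℝ) : ℂ) • pencil L J (x : ℂ) := by
    rw [pencil, ← hK, smul_sub, smul_smul, ← Complex.ofReal_mul, inv_mul_cancel₀ hx.ne', Complex.ofReal_one, one_smul]
  have e2 : M (-x⁻¹) = ((-x⁻¹ : ℝ) : ℂ) • pencil L J ((-x : ℝ) : ℂ) := by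
    rw [pencil, ← hK, smul_sub, smul_smul, ← Complex.ofReal_mul, neg_mul_neg,
      inv_mul_cancel₀ hx.ne', Complex.ofReal_one, one_smul]
  have e3 : signature (pencil L J ((-x : ℝ) : ℂ)) = signature (pencil L J (x : ℂ)) := by
    rw [signature, hsymm, signature]
  -- The equality of the signatures of `M(1/x)` and `M(-1/x)` becomes `s = -s` for `s` the signature
  -- of `𝓛(x)`.
  rw [← h2, e1, e2, signature_smul _ hx', signature_smul _ (neg_ne_zero.2 hx'), e3,
    sign_pos (inv_pos.2 hx), sign_neg (neg_neg_iff_pos.2 (inv_pos.2 hx))] at h1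
  simp only [SignType.coe_one, SignType.coe_neg, one_mul, neg_mul] at h1
  omega

end Curves

/-! ### Characteristic values as roots, and their symmetries -/

section SpectralPolynomial

open Polynomial

variable {N : ℕ} {L J : Matrix (Fin N) (Fin N) ℂ}

/-- The monic polynomial proportional to `det 𝓛`. -/
noncomputable def specPoly (L J : Matrix (Fin N) (Fin N) ℂ) : ℂ[X] :=
  (Complex.I • (J * L)).charpoly

lemma specPoly_ne_zero : specPoly L J ≠ 0 := (Matrix.charpoly_monic _).ne_zero

/-- Factor `z - iJL = -(iJ)(L - zK)`, using `iJ K = 1`. -/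
lemma eval_specPoly (hJu : IsUnit J) (z : ℂ) :
    (specPoly L J).eval z = (-1) ^ N * (Complex.I • J).det * (pencil L J z).det := by
  have hB := (Matrix.isUnit_iff_isUnit_det _).1 (isUnit_I_smul hJu)
  have h : Matrix.scalar (Fin N) z - Complex.I • (J * L) =
      -((Complex.I • J) * pencil L J z) := by
    rw [pencil, Matrix.mul_sub, Matrix.mul_smul, Matrix.mul_nonsing_inv _ hB, neg_sub,
      Matrix.smul_mul]
    congr 1
    ext i j
    simp [Matrix.scalar_apply, Matrix.diagonal_apply, Matrix.one_apply]
  rw [specPoly, Matrix.eval_charpoly, h, Matrix.det_neg, Matrix.det_mul, Fintype.card_fin,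
    mul_assoc]

lemma mem_charValues_iff (hJu : IsUnit J) {z : ℂ} :
    z ∈ charValues L J ↔ z ∈ (specPoly L J).roots := by
  have hB := ((Matrix.isUnit_iff_isUnit_det _).1 (isUnit_I_smul hJu)).ne_zero
  rw [mem_roots specPoly_ne_zero, IsRoot, eval_specPoly hJu, mul_eq_zero, or_iff_right]
  · rfl
  · exact mul_ne_zero (pow_ne_zero _ (by simp)) hB

lemma charValues_finite (hJu : IsUnit J) : (charValues L J).Finite := by
  refine (Multiset.finite_toSet (specPoly L J).roots).subset fun z hz => ?_
  exact (mem_charValues_iff hJu).1 hz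

lemma roots_specPoly :
    (specPoly L J).roots = (J * L).charpoly.roots.map (fun z => Complex.I * z) :=
  roots_charpoly_smul _ Complex.I_ne_zero

lemma card_roots_specPoly : (specPoly L J).roots.card = N := by
  rw [← (IsAlgClosed.splits _).natDegree_eq_card_roots, specPoly,
    Matrix.charpoly_natDegree_eq_dim, Fintype.card_fin]

lemma unstableMultiplicity_eq :
    unstableMultiplicity (J * L) = ((specPoly L J).roots.filter fun z => z.im ≠ 0).card := by
  classical
  rw [unstableMultiplicity, roots_specPoly, Multiset.filter_map, Multiset.card_map]
  congr 1
  refine Multiset.filter_congr fun z _ => ?_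
  simp

lemma dimGKer_eq : dimGKer (J * L) = (specPoly L J).roots.count 0 := by
  classical
  rw [dimGKer, LinearMap.finrank_maxGenEigenspace_eq, Matrix.charpoly_toLin', ← count_roots,
    roots_specPoly]
  have h := Multiset.count_map_eq_count' (fun z => Complex.I * z) (J * L).charpoly.roots
    (mul_right_injective₀ Complex.I_ne_zero) 0
  rw [mul_zero] at h
  exact h.symm

/-- The adjoint of `(iJ)L` is `L(iJ)`, which has the same characteristic polynomial. -/
lemma map_conj_roots_specPoly (hL : L.IsHermitian) (hJ : J.conjTranspose = -J) :
    (specPoly L J).roots.map (starRingEnd ℂ) = (specPoly L J).roots := by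
  have h1 : (specPoly L J).map (starRingEnd ℂ) = specPoly L J := by
    rw [specPoly, ← Matrix.charpoly_map]
    change ((Complex.I • (J * L)).map (starRingEnd ℂ)).charpoly = _
    rw [charpoly_map_conj, Matrix.conjTranspose_smul, Matrix.conjTranspose_mul, hL.eq, hJ,
      ← Matrix.smul_mul, ← Matrix.mul_smul, Matrix.charpoly_mul_comm]
    simp
  conv_rhs => rw [← h1]
  rw [(IsAlgClosed.splits (specPoly L J)).roots_map]

/-- The symmetry is known for real parameters only; infinitely many points determine a polynomial.
-/
lemma map_neg_roots_specPoly (hJu : IsUnit J)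
    (hsymm : ∀ x : ℝ, (pencil L J ((-x : ℝ) : ℂ)).charpoly = (pencil L J (x : ℂ)).charpoly) :
    (specPoly L J).roots.map (fun z => -z) = (specPoly L J).roots := by
  rw [← roots_comp_neg_X]
  congr 1
  refine eq_of_infinite_eval_eq _ _ ((Set.infinite_range_of_injective
    Complex.ofReal_injective).mono ?_)
  rintro _ ⟨x, rfl⟩
  have h1 := hsymm x
  simp only [Set.mem_ofPred_eq, eval_comp, eval_neg, eval_X]
  rw [eval_specPoly hJu, eval_specPoly hJu, Matrix.det_eq_prod_roots_charpoly (pencil L J (x : ℂ)),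
    ← h1, ← Matrix.det_eq_prod_roots_charpoly]
  simp

end SpectralPolynomial

/-! ### Multiplicities, indices and signatures read off from the curves -/

section CurveCounting

open Polynomial

variable {N : ℕ} {L J : Matrix (Fin N) (Fin N) ℂ} {μ : Fin N → ℝ → ℝ}

lemma ofReal_mem_charValues_iff (hμ : IsEigenvalueCurves L J μ) (x : ℝ) :
    (x : ℂ) ∈ charValues L J ↔ ∃ j, μ j x = 0 := by
  change (pencil L J (x : ℂ)).det = 0 ↔ _
  rw [det_pencil_eq_prod hμ, Complex.ofReal_eq_zero, Finset.prod_eq_zero_iff]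
  simp

lemma finite_real_charValues (hJu : IsUnit J) : {x : ℝ | (x : ℂ) ∈ charValues L J}.Finite :=
  (charValues_finite hJu).preimage Complex.ofReal_injective.injOn

/-- A curve vanishing near `x` would give infinitely many characteristic values. Hence
`vanishingOrder` is the true order, not the default `0` of an infinite one. -/
lemma IsEigenvalueCurves.order_ne_top (hμ : IsEigenvalueCurves L J μ) (hJu : IsUnit J) (j : Fin N)
    (x : ℝ) : analyticOrderAt (μ j) x ≠ ⊤ := by
  intro h
  rw [analyticOrderAt_eq_top] at h
  refine infinite_of_mem_nhds x (h.mono fun y hy => ?_) (finite_real_charValues (L := L) hJu)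
  exact (ofReal_mem_charValues_iff hμ y).2 ⟨j, hy⟩

lemma analyticAt_eval_ofReal (p : ℂ[X]) (x₀ : ℝ) :
    AnalyticAt ℝ (fun x : ℝ => p.eval (x : ℂ)) x₀ := by
  simp only [eval_eq_sum_range]
  refine Finset.analyticAt_fun_sum _ fun i _ => ?_
  exact analyticAt_const.mul ((Complex.ofRealCLM.analyticAt x₀).pow i)

/-- The multiplicity of a real characteristic value is the sum of the vanishing orders. -/
theorem count_roots_specPoly (hμ : IsEigenvalueCurves L J μ) (hJu : IsUnit J) (x₀ : ℝ) :
    (specPoly L J).roots.count (x₀ : ℂ) = ∑ j, vanishingOrder (μ j) x₀ := by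
  -- The order of `specPoly` on the real line is computed twice: from its root multiplicity and from
  -- the product of the curves.
  have hf := analyticAt_eval_ofReal (specPoly L J) x₀
  have h1 : analyticOrderAt (fun x : ℝ => (specPoly L J).eval (x : ℂ)) x₀ =
      ((specPoly L J).rootMultiplicity (x₀ : ℂ) : ℕ) := by
    obtain ⟨q, hq, hqd⟩ :=
      exists_eq_pow_rootMultiplicity_mul_and_not_dvd (specPoly L J) specPoly_ne_zero (x₀ : ℂ)
    refine hf.analyticOrderAt_eq_natCast.2 ⟨fun x => q.eval (x : ℂ), analyticAt_eval_ofReal q x₀,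
      fun h => hqd (dvd_iff_isRoot.2 h), Eventually.of_forall fun x => ?_⟩
    conv_lhs => rw [hq]
    simp
  have h2 : analyticOrderAt (fun x : ℝ => (specPoly L J).eval (x : ℂ)) x₀ =
      ((∑ j, vanishingOrder (μ j) x₀ : ℕ) : ℕ∞) := by
    choose g hg hg0 hfg using fun j => ((hμ.analytic j x₀).analyticOrderAt_eq_natCast).1
      (Nat.cast_analyticOrderNatAt (hμ.order_ne_top hJu j x₀)).symm
    set c : ℂ := (-1) ^ N * (Complex.I • J).det with hc
    have hc0 : c ≠ 0 := mul_ne_zero (pow_ne_zero _ (by simp))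
      ((Matrix.isUnit_iff_isUnit_det _).1 (isUnit_I_smul hJu)).ne_zero
    have hga : AnalyticAt ℝ (fun x => ∏ j, g j x) x₀ := Finset.analyticAt_fun_prod _ fun j _ => hg j
    refine hf.analyticOrderAt_eq_natCast.2 ⟨fun x => c * ((∏ j, g j x : ℝ) : ℂ),
      analyticAt_const.mul ((Complex.ofRealCLM.analyticAt _).comp hga), ?_, ?_⟩
    · exact mul_ne_zero hc0 (Complex.ofReal_ne_zero.2 (Finset.prod_ne_zero_iff.2 fun j _ => hg0 j))
    · filter_upwards [eventually_all.2 hfg] with x hx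
      rw [eval_specPoly hJu, det_pencil_eq_prod hμ, ← hc, Finset.prod_congr rfl fun j _ => hx j]
      simp only [smul_eq_mul, Finset.prod_mul_distrib, Finset.prod_pow_eq_pow_sum,
        Complex.ofReal_mul, Complex.real_smul]
      simp only [vanishingOrder]
      ring
  rw [count_roots]
  exact_mod_cast h1.symm.trans h2

lemma kreinPos_eq (μ : Fin N → ℝ → ℝ) (x₀ : ℝ) :
    kreinPos μ x₀ = ((∑ j, vanishingOrder (μ j) x₀ : ℕ) + (∑ j, signJump (μ j) x₀ : ℤ) : ℚ) / 2 := by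
  classical
  rw [kreinPos, Finset.sum_filter_of_ne fun j _ hj => ?_]
  · simp only [curveKreinPos_eq, ← Finset.sum_div, Finset.sum_add_distrib]
    push_cast
    rfl
  · by_contra h0
    apply hj
    rw [curveKreinPos_eq, vanishingOrder_eq_zero h0, signJump_eq_zero h0]
    simp

lemma kreinNeg_eq (μ : Fin N → ℝ → ℝ) (x₀ : ℝ) :
    kreinNeg μ x₀ = ((∑ j, vanishingOrder (μ j) x₀ : ℕ) - (∑ j, signJump (μ j) x₀ : ℤ) : ℚ) / 2 := by
  classical
  rw [kreinNeg, Finset.sum_filter_of_ne fun j _ hj => ?_]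
  · simp only [curveKreinNeg_eq, ← Finset.sum_div, Finset.sum_sub_distrib]
    push_cast
    rfl
  · by_contra h0
    apply hj
    rw [curveKreinNeg_eq, vanishingOrder_eq_zero h0, signJump_eq_zero h0]
    simp

/-- The signature of the pencil changes by the jumps of the curves. -/
lemma signature_sub_signature (hμ : IsEigenvalueCurves L J μ) (hJu : IsUnit J) {a b : ℝ}
    (hab : a < b) (ha : (a : ℂ) ∉ charValues L J) (hb : (b : ℂ) ∉ charValues L J) (Z : Finset ℝ)
    (hZ : ∀ x, x ∈ Z ↔ (x : ℂ) ∈ charValues L J ∧ x ∈ Set.Ioo a b) :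
    signature (pencil L J (b : ℂ)) - signature (pencil L J (a : ℂ)) =
      2 * ∑ x ∈ Z, ∑ j, signJump (μ j) x := by
  rw [signature_eq_sum (hμ.charpoly_eq a), signature_eq_sum (hμ.charpoly_eq b),
    ← Finset.sum_sub_distrib, Finset.sum_comm, Finset.mul_sum]
  rw [ofReal_mem_charValues_iff hμ] at ha hb
  push Not at ha hb
  refine Finset.sum_congr rfl fun j _ => ?_
  exact sign_sub_sign_eq_sum_signJump (hμ.analytic j) (hμ.order_ne_top hJu j) (ha j) Z b hab (hb j)
    (fun x hx => ((hZ x).1 hx).2)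
    fun x hx hx0 => (hZ x).2 ⟨(ofReal_mem_charValues_iff hμ x).2 ⟨j, hx0⟩, hx⟩

lemma sum_vanishingOrder_eq_card (hμ : IsEigenvalueCurves L J μ) (hJu : IsUnit J) (p : ℝ → Prop)
    [DecidablePred fun z : ℂ => z.im = 0 ∧ p z.re] (Z : Finset ℝ)
    (hZ : ∀ x, x ∈ Z ↔ (x : ℂ) ∈ charValues L J ∧ p x) :
    ∑ x ∈ Z, ∑ j, vanishingOrder (μ j) x =
      ((specPoly L J).roots.filter fun z => z.im = 0 ∧ p z.re).card := by
  classical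
  rw [← Multiset.sum_count_eq_card (s := Z.map ⟨_, Complex.ofReal_injective⟩), Finset.sum_map]
  · refine Finset.sum_congr rfl fun x hx => ?_
    rw [← count_roots_specPoly hμ hJu, Multiset.count_filter_of_pos]
    · rfl
    · exact ⟨Complex.ofReal_im x, ((hZ x).1 hx).2⟩
  · intro z hz
    obtain ⟨h1, h2, h3⟩ := Multiset.mem_filter.1 hz
    have h4 : ((z.re : ℝ) : ℂ) = z := Complex.ext (by simp) (by simp [h2])
    refine Finset.mem_map.2 ⟨z.re, (hZ _).2 ⟨?_, h3⟩, h4⟩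
    rw [h4]
    exact (mem_charValues_iff hJu).2 h1

lemma eventually_neg_or_pos (hμ : IsEigenvalueCurves L J μ) (hJu : IsUnit J) (j : Fin N) :
    ((∀ᶠ x in 𝓝[>] 0, μ j x < 0) ∨ ∀ᶠ x in 𝓝[>] 0, 0 < μ j x) ∧
      ((∀ᶠ x in 𝓝[<] 0, μ j x < 0) ∨ ∀ᶠ x in 𝓝[<] 0, 0 < μ j x) := by
  obtain ⟨hr, hl⟩ := eventually_sign_eq (hμ.analytic j 0) (hμ.order_ne_top hJu j 0)
  have hlead := (exists_leading_factor (hμ.analytic j 0) (hμ.order_ne_top hJu j 0)).1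
  have key : ∀ (l : Filter ℝ) (s : SignType), s ≠ 0 → (∀ᶠ x in l, SignType.sign (μ j x) = s) →
      (∀ᶠ x in l, μ j x < 0) ∨ ∀ᶠ x in l, 0 < μ j x := by
    intro l s hs h
    cases s with
    | zero => exact absurd rfl hs
    | neg => exact Or.inl (h.mono fun x hx => sign_eq_neg_one_iff.1 hx)
    | pos => exact Or.inr (h.mono fun x hx => sign_eq_one_iff.1 hx)
  exact ⟨key _ _ (sign_ne_zero.2 hlead) hr,
    key _ _ (mul_ne_zero (pow_ne_zero _ (by decide)) (sign_ne_zero.2 hlead)) hl⟩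

/-- Curves nonzero at `0` keep their sign nearby; those through `0` have a fixed sign along `l`.
Each negative one lowers the signature by `2` from `N`. -/
lemma eventually_signature_eq (hμ : IsEigenvalueCurves L J μ) {l : Filter ℝ} [l.NeBot]
    (hl : l ≤ 𝓝 0) (h : ∀ j, (∀ᶠ x in l, μ j x < 0) ∨ ∀ᶠ x in l, 0 < μ j x) :
    ∀ᶠ x : ℝ in l, signature (pencil L J (x : ℂ)) = (N : ℤ) - 2 * Set.ncard {j | μ j 0 < 0} -
      2 * Set.ncard {j | μ j 0 = 0 ∧ ∀ᶠ x in l, μ j x < 0} := by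
  classical
  have hsign : ∀ᶠ x in l, ∀ j, (SignType.sign (μ j x) : ℤ) = 1 - 2 * (if μ j 0 < 0 then 1 else 0) -
      2 * (if μ j 0 = 0 ∧ ∀ᶠ x in l, μ j x < 0 then 1 else 0) := by
    refine eventually_all.2 fun j => ?_
    have hc : Tendsto (μ j) l (𝓝 (μ j 0)) := (hμ.analytic j 0).continuousAt.tendsto.mono_left hl
    rcases lt_trichotomy (μ j 0) 0 with h0 | h0 | h0
    · filter_upwards [hc.eventually (gt_mem_nhds h0)] with x hx
      simp [sign_neg hx, h0, h0.ne]
    · rcases h j with h1 | h1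
      · filter_upwards [h1] with x hx
        simp [sign_neg hx, h0, h1]
      · have h2 : ¬ ∀ᶠ x in l, μ j x < 0 := fun h2 => by
          obtain ⟨x, hx1, hx2⟩ := (h1.and h2).exists
          exact lt_asymm hx1 hx2
        filter_upwards [h1] with x hx
        simp [sign_pos hx, h0, h2]
    · filter_upwards [hc.eventually (lt_mem_nhds h0)] with x hx
      simp [sign_pos hx, h0.not_gt, h0.ne']
  filter_upwards [hsign] with x hx
  rw [signature_eq_sum (hμ.charpoly_eq x), Finset.sum_congr rfl fun j _ => hx j,
    Set.ncard_eq_toFinset_card', Set.ncard_eq_toFinset_card', Finset.sum_sub_distrib,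
    Finset.sum_sub_distrib, ← Finset.mul_sum, ← Finset.mul_sum, Finset.sum_boole, Finset.sum_boole]
  simp

lemma ncard_down_add_ncard_up {l : Filter ℝ} [l.NeBot]
    (h : ∀ j, (∀ᶠ x in l, μ j x < 0) ∨ ∀ᶠ x in l, 0 < μ j x) :
    Set.ncard {j | μ j 0 = 0 ∧ ∀ᶠ x in l, μ j x < 0} +
      Set.ncard {j | μ j 0 = 0 ∧ ∀ᶠ x in l, 0 < μ j x} = Set.ncard {j | μ j 0 = 0} := by
  rw [← Set.ncard_union_eq]
  · congr 1
    ext j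
    have := h j
    simp only [Set.mem_union, Set.mem_ofPred_eq]
    tauto
  · rw [Set.disjoint_left]
    rintro j ⟨-, h1⟩ ⟨-, h2⟩
    obtain ⟨x, hx1, hx2⟩ := (h1.and h2).exists
    exact lt_asymm hx1 hx2

lemma ncard_eq_countP (a : Fin N → ℝ) (p : ℝ → Prop) [DecidablePred p] :
    Set.ncard {j | p (a j)} = Multiset.countP p (Finset.univ.val.map a) := by
  classical
  rw [Set.ncard_eq_toFinset_card', Multiset.countP_map]
  simp only [Set.toFinset_ofPred]
  rfl

lemma map_eigenvalues_eq (hμ : IsEigenvalueCurves L J μ) (hL : L.IsHermitian) :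
    Finset.univ.val.map hL.eigenvalues = Finset.univ.val.map fun j => μ j 0 := by
  have h1 := hμ.charpoly_eq 0
  rw [pencil, Complex.ofReal_zero, zero_smul, sub_zero, hL.charpoly_eq] at h1
  have h2 := congrArg Polynomial.roots h1
  rw [roots_prod_X_sub_C, roots_prod_X_sub_C] at h2
  refine Multiset.map_injective Complex.ofReal_injective ?_
  rw [Multiset.map_map, Multiset.map_map]
  exact h2

lemma negIndex_eq (hμ : IsEigenvalueCurves L J μ) (hL : L.IsHermitian) :
    negIndex hL = Set.ncard {j | μ j 0 < 0} := by
  classical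
  rw [negIndex, ncard_eq_countP hL.eigenvalues (· < 0), map_eigenvalues_eq hμ hL,
    ← ncard_eq_countP (fun j => μ j 0) (· < 0)]

/-- Rank-nullity applies, because the rank of a Hermitian matrix is the number of its nonzero
eigenvalues. -/
lemma dimKer_eq (hμ : IsEigenvalueCurves L J μ) (hL : L.IsHermitian) :
    dimKer L = Set.ncard {j | μ j 0 = 0} := by
  classical
  have h0 := ncard_eq_countP (fun j => μ j 0) (· = 0)
  rw [← map_eigenvalues_eq hμ hL, ← ncard_eq_countP hL.eigenvalues (· = 0)] at h0
  refine Eq.trans ?_ h0.symm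
  have h1 := LinearMap.finrank_range_add_finrank_ker (Matrix.toLin' L)
  have h2 : Module.finrank ℂ (LinearMap.range (Matrix.toLin' L)) = L.rank := rfl
  rw [h2, hL.rank_eq_card_non_zero_eigs, Module.finrank_fin_fun] at h1
  have h3 := Set.ncard_add_ncard_compl {j | hL.eigenvalues j = 0}
  have h4 : Fintype.card {i // hL.eigenvalues i ≠ 0} = Set.ncard {j | hL.eigenvalues j = 0}ᶜ := by
    rw [Set.ncard_eq_toFinset_card', Set.toFinset_card]
    rfl
  rw [Nat.card_eq_fintype_card, Fintype.card_fin] at h3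
  change _ + dimKer L = N at h1
  omega

lemma zNeg_eq_zDownRight (hμ : IsEigenvalueCurves L J μ) (hJu : IsUnit J) :
    zNeg μ = zDownRight μ := by
  rw [zNeg, zDownRight]
  congr 1
  ext j
  have hr := (eventually_sign_eq (hμ.analytic j 0) (hμ.order_ne_top hJu j 0)).1
  refine and_congr_right fun _ => ⟨fun h => hr.mono fun x hx => ?_, fun h => ?_⟩
  · rwa [sign_neg h, sign_eq_neg_one_iff] at hx
  · obtain ⟨x, h1, h2⟩ := (hr.and h).exists
    rwa [sign_neg h2, eq_comm, sign_eq_neg_one_iff] at h1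

lemma zPos_eq_zUpRight (hμ : IsEigenvalueCurves L J μ) (hJu : IsUnit J) :
    zPos μ = zUpRight μ := by
  rw [zPos, zUpRight]
  congr 1
  ext j
  have hr := (eventually_sign_eq (hμ.analytic j 0) (hμ.order_ne_top hJu j 0)).1
  refine and_congr_right fun _ => ⟨fun h => hr.mono fun x hx => ?_, fun h => ?_⟩
  · rwa [sign_pos h, sign_eq_one_iff] at hx
  · obtain ⟨x, h1, h2⟩ := (hr.and h).exists
    rwa [sign_pos h2, eq_comm, sign_eq_one_iff] at h1

end CurveCounting

/-! ### Balancing root counts against signature changes -/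

section IndexFormula

open Polynomial

variable {N : ℕ} {L J : Matrix (Fin N) (Fin N) ℂ} {μ : Fin N → ℝ → ℝ}

lemma unstableMultiplicity_eq_two_mul (hL : L.IsHermitian) (hJ : J.conjTranspose = -J) :
    unstableMultiplicity (J * L) = 2 * ((specPoly L J).roots.filter fun z => 0 < z.im).card := by
  classical
  have h1 : ((specPoly L J).roots.filter fun z => z.im < 0).card =
      ((specPoly L J).roots.filter fun z => 0 < z.im).card := by
    conv_lhs => rw [← map_conj_roots_specPoly hL hJ]
    rw [Multiset.filter_map, Multiset.card_map]
    congr 1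
    exact Multiset.filter_congr fun z _ => by simp
  have h2 : ((specPoly L J).roots.filter fun z => z.im ≠ 0) =
      ((specPoly L J).roots.filter fun z => z.im < 0) +
        ((specPoly L J).roots.filter fun z => 0 < z.im) := by
    rw [Multiset.filter_add_filter, (Multiset.filter_eq_nil (p := fun z : ℂ => z.im < 0 ∧ 0 < z.im)
      (s := (specPoly L J).roots)).2 fun z _ h => lt_asymm h.1 h.2, add_zero]
    exact Multiset.filter_congr fun z _ => ne_iff_lt_or_gt
  rw [unstableMultiplicity_eq]
  calc _ = ((specPoly L J).roots.filter fun z => z.im ≠ 0).card := by congr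
    _ = _ := by rw [h2, Multiset.card_add, h1, two_mul]

open Classical in
lemma card_filter_neg_eq_card_filter_pos (hJu : IsUnit J)
    (hsymm : ∀ x : ℝ, (pencil L J ((-x : ℝ) : ℂ)).charpoly = (pencil L J (x : ℂ)).charpoly) :
    ((specPoly L J).roots.filter fun z => z.im = 0 ∧ z.re < 0).card =
      ((specPoly L J).roots.filter fun z => z.im = 0 ∧ 0 < z.re).card := by
  conv_lhs => rw [← map_neg_roots_specPoly hJu hsymm]
  rw [Multiset.filter_map, Multiset.card_map]
  congr 1
  exact Multiset.filter_congr fun z _ => by simp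

open Classical in
/-- All characteristic values are accounted for. -/
lemma card_eq_unstable_add_dimGKer_add :
    N = unstableMultiplicity (J * L) + dimGKer (J * L) +
      ((specPoly L J).roots.filter fun z => z.im = 0 ∧ z.re < 0).card +
      ((specPoly L J).roots.filter fun z => z.im = 0 ∧ 0 < z.re).card := by
  rw [unstableMultiplicity_eq, dimGKer_eq]
  conv_lhs => rw [← card_roots_specPoly (L := L) (J := J)]
  generalize (specPoly L J).roots = R
  induction R using Multiset.induction_on with
  | empty => simp
  | cons z R ih =>
    rw [Multiset.card_cons, ih]
    simp only [Multiset.filter_cons, Multiset.card_add, Multiset.count_cons]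
    by_cases hi : z.im = 0
    · rcases lt_trichotomy z.re 0 with h | h | h
      · have hz : (0 : ℂ) ≠ z := fun h0 => by simp [← h0] at h
        simp [hi, h, h.not_gt, hz]
        ring
      · have hz : (0 : ℂ) = z := Complex.ext (by simp [h]) (by simp [hi])
        simp [← hz]
        ring
      · have hz : (0 : ℂ) ≠ z := fun h0 => by simp [← h0] at h
        simp [hi, h, h.not_gt, hz]
        ring
    · have hz : (0 : ℂ) ≠ z := fun h0 => by simp [← h0] at hi
      simp [hi, hz]
      ring

lemma eventually_notMem_charValues (hJu : IsUnit J) :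
    ∀ᶠ x : ℝ in atTop, ∀ y : ℝ, (y : ℂ) ∈ charValues L J → |y| < x := by
  have h := (Filter.eventually_all_finite (finite_real_charValues (L := L) hJu)).2
    (fun y _ => eventually_gt_atTop |y|)
  exact h

lemma eventually_small_of_mem_charValues (hJu : IsUnit J) :
    ∀ᶠ x : ℝ in 𝓝 0, ∀ y : ℝ, (y : ℂ) ∈ charValues L J → y ≠ 0 → |x| < |y| := by
  refine (Filter.eventually_all_finite (finite_real_charValues (L := L) hJu)).2 fun y _ => ?_
  by_cases hy : y = 0
  · exact Eventually.of_forall fun x h0 => absurd hy h0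
  · have : Tendsto (fun x : ℝ => |x|) (𝓝 0) (𝓝 0) := by
      simpa using (continuous_abs (G := ℝ)).tendsto 0
    filter_upwards [this.eventually (gt_mem_nhds (abs_pos.2 hy))] with x hx _ using hx

lemma signature_pencil_neg
    (hsymm : ∀ x : ℝ, (pencil L J ((-x : ℝ) : ℂ)).charpoly = (pencil L J (x : ℂ)).charpoly)
    (x : ℝ) : signature (pencil L J ((-x : ℝ) : ℂ)) = signature (pencil L J (x : ℂ)) := by
  rw [signature, hsymm, signature]

lemma eventually_signature_right (hμ : IsEigenvalueCurves L J μ) (hJu : IsUnit J) :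
    ∀ᶠ x : ℝ in 𝓝[>] 0, signature (pencil L J (x : ℂ)) =
      (N : ℤ) - 2 * Set.ncard {j | μ j 0 < 0} - 2 * zDownRight μ :=
  eventually_signature_eq hμ nhdsWithin_le_nhds fun j => (eventually_neg_or_pos hμ hJu j).1

lemma eventually_signature_left (hμ : IsEigenvalueCurves L J μ) (hJu : IsUnit J) :
    ∀ᶠ x : ℝ in 𝓝[<] 0, signature (pencil L J (x : ℂ)) =
      (N : ℤ) - 2 * Set.ncard {j | μ j 0 < 0} - 2 * zDownLeft μ :=
  eventually_signature_eq hμ nhdsWithin_le_nhds fun j => (eventually_neg_or_pos hμ hJu j).2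

/-- The signatures at `x` and `-x` agree, and near `0` they differ only through these two counts. -/
lemma zDownLeft_eq_zDownRight (hμ : IsEigenvalueCurves L J μ) (hJu : IsUnit J)
    (hsymm : ∀ x : ℝ, (pencil L J ((-x : ℝ) : ℂ)).charpoly = (pencil L J (x : ℂ)).charpoly) :
    zDownLeft μ = zDownRight μ := by
  have hneg : Tendsto (fun x : ℝ => -x) (𝓝[>] 0) (𝓝[<] 0) := by
    simpa using tendsto_neg_nhdsGT (a := (0 : ℝ))
  obtain ⟨x, h1, h2⟩ := ((eventually_signature_right hμ hJu).and
    (hneg.eventually (eventually_signature_left hμ hJu))).exists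
  rw [signature_pencil_neg hsymm, h1] at h2
  omega

open Classical in
/-- The total positive Krein index on the positive half-axis. -/
lemma two_mul_sumKreinPos (hL : L.IsHermitian) (hJ : J.conjTranspose = -J)
    (hμ : IsEigenvalueCurves L J μ) (hJu : IsUnit J)
    (hsymm : ∀ x : ℝ, (pencil L J ((-x : ℝ) : ℂ)).charpoly = (pencil L J (x : ℂ)).charpoly) :
    2 * sumKreinPos L J μ = ((specPoly L J).roots.filter fun z => z.im = 0 ∧ 0 < z.re).card -
      (N : ℚ) / 2 + Set.ncard {j | μ j 0 < 0} + zDownRight μ := by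
  have hfin : {x : ℝ | (x : ℂ) ∈ charValues L J ∧ 0 < x}.Finite :=
    (finite_real_charValues hJu).subset fun x hx => hx.1
  -- `(a, b)` contains exactly the positive characteristic values; the signature is known at `a` and
  -- is zero at `b`.
  obtain ⟨a, ha1, ha2, ha3⟩ := ((eventually_signature_right hμ hJu).and
    (((eventually_small_of_mem_charValues (L := L) hJu).filter_mono nhdsWithin_le_nhds).and
      self_mem_nhdsWithin)).exists
  obtain ⟨b, hb1, hb2, hb3⟩ := ((eventually_signature_pencil_eq_zero hL hJ hJu hsymm).and
    ((eventually_notMem_charValues (L := L) hJu).and (eventually_gt_atTop a))).exists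
  have ha3 : 0 < a := ha3
  have hZ : ∀ x, x ∈ hfin.toFinset ↔ (x : ℂ) ∈ charValues L J ∧ 0 < x := fun x => by simp
  have hjump := signature_sub_signature hμ hJu hb3
    (fun h => (ha2 a h ha3.ne').false) (fun h => absurd (hb2 b h) (le_abs_self b).not_gt)
    hfin.toFinset (fun x => (hZ x).trans (and_congr_right fun hx => ⟨fun h0 => ⟨?_, ?_⟩,
      fun h0 => ha3.trans h0.1⟩))
  · have hcard := sum_vanishingOrder_eq_card hμ hJu (fun x => 0 < x) hfin.toFinset hZ
    rw [sumKreinPos, finsum_mem_eq_finite_toFinset_sum _ hfin]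
    simp only [kreinPos_eq]
    rw [← Finset.sum_div, Finset.sum_add_distrib, ← Nat.cast_sum, ← Int.cast_sum, hcard]
    rw [hb1, ha1] at hjump
    have hjump' := congrArg (Int.cast : ℤ → ℚ) hjump
    push_cast at hjump' ⊢
    linarith
  · have := ha2 x hx h0.ne'
    rwa [abs_of_pos ha3, abs_of_pos h0] at this
  · exact (le_abs_self x).trans_lt (hb2 x hx)

open Classical in
/-- The total negative Krein index on the negative half-axis. -/
lemma two_mul_sumKreinNeg (hL : L.IsHermitian) (hJ : J.conjTranspose = -J)
    (hμ : IsEigenvalueCurves L J μ) (hJu : IsUnit J)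
    (hsymm : ∀ x : ℝ, (pencil L J ((-x : ℝ) : ℂ)).charpoly = (pencil L J (x : ℂ)).charpoly) :
    2 * sumKreinNeg L J μ = ((specPoly L J).roots.filter fun z => z.im = 0 ∧ z.re < 0).card -
      (N : ℚ) / 2 + Set.ncard {j | μ j 0 < 0} + zDownLeft μ := by
  have hfin : {x : ℝ | (x : ℂ) ∈ charValues L J ∧ x < 0}.Finite :=
    (finite_real_charValues hJu).subset fun x hx => hx.1
  obtain ⟨a, ha1, ha2, ha3⟩ := ((eventually_signature_left hμ hJu).and
    (((eventually_small_of_mem_charValues (L := L) hJu).filter_mono nhdsWithin_le_nhds).and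
      self_mem_nhdsWithin)).exists
  obtain ⟨b, hb1, hb2, hb3⟩ := ((eventually_signature_pencil_eq_zero hL hJ hJu hsymm).and
    ((eventually_notMem_charValues (L := L) hJu).and (eventually_gt_atTop (-a)))).exists
  have ha3 : a < 0 := ha3
  have hZ : ∀ x, x ∈ hfin.toFinset ↔ (x : ℂ) ∈ charValues L J ∧ x < 0 := fun x => by simp
  -- On `(-b, a)` the known signature is at the right end, which reverses the sign of the jump sum;
  -- `κ⁻` subtracts the jumps, so the result has the same shape.
  have hjump := signature_sub_signature hμ hJu (neg_lt.1 hb3)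
    (fun h => absurd (hb2 (-b) h) (by rw [abs_neg]; exact (le_abs_self b).not_gt))
    (fun h => (ha2 a h ha3.ne).false)
    hfin.toFinset (fun x => (hZ x).trans (and_congr_right fun hx => ⟨fun h0 => ⟨?_, ?_⟩,
      fun h0 => h0.2.trans ha3⟩))
  · have hcard := sum_vanishingOrder_eq_card hμ hJu (fun x => x < 0) hfin.toFinset hZ
    rw [sumKreinNeg, finsum_mem_eq_finite_toFinset_sum _ hfin]
    simp only [kreinNeg_eq]
    rw [← Finset.sum_div, Finset.sum_sub_distrib, ← Nat.cast_sum, ← Int.cast_sum, hcard]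
    rw [signature_pencil_neg hsymm, hb1, ha1] at hjump
    have hjump' := congrArg (Int.cast : ℤ → ℚ) hjump
    push_cast at hjump' ⊢
    linarith
  · exact neg_lt.1 ((neg_le_abs x).trans_lt (hb2 x hx))
  · have := ha2 x hx h0.ne
    rw [abs_of_neg ha3, abs_of_neg h0] at this
    linarith

end IndexFormula
end HamiltonianIndex

theorem corollary1 (n : ℕ) (L J : Matrix (Fin (2 * n)) (Fin (2 * n)) ℂ)
    (hL : L.IsHermitian) (hJ : J.conjTranspose = -J) (hJu : IsUnit J)
    (I : EuclideanSpace ℂ (Fin (2 * n)) →ₗᵢ⋆[ℂ] EuclideanSpace ℂ (Fin (2 * n)))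
    (hI : Function.Involutive I)
    (hLI : HamiltonianIndex.IsRealWrt I L) (hJI : HamiltonianIndex.IsRealWrt I J) :
    -- all quantities are well defined: `σ(𝓛)` is finite, the analytic curves exist, and the
    -- multiplicity of the unstable spectrum is an even number `2 n_u`
    (HamiltonianIndex.charValues L J).Finite ∧
    (∃ μ : Fin (2 * n) → ℝ → ℝ, HamiltonianIndex.IsEigenvalueCurves L J μ) ∧
    ∃ nu : ℕ, HamiltonianIndex.unstableMultiplicity (J * L) = 2 * nu ∧
      ∀ μ : Fin (2 * n) → ℝ → ℝ, HamiltonianIndex.IsEigenvalueCurves L J μ →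
        -- the two counts of the unstable spectrum
        (nu : ℚ) = (HamiltonianIndex.negIndex hL : ℚ) - HamiltonianIndex.zeta L J μ
          - 2 * HamiltonianIndex.sumKreinPos L J μ ∧
        (nu : ℚ) = (HamiltonianIndex.negIndex hL : ℚ) - HamiltonianIndex.zeta L J μ
          - 2 * HamiltonianIndex.sumKreinNeg L J μ ∧
        -- the equivalent form of the definition of `ζ`
        HamiltonianIndex.zeta L J μ =
          ((HamiltonianIndex.dimGKer (J * L) : ℚ) - 2 * (HamiltonianIndex.dimKer L : ℚ)) / 2
          + ((HamiltonianIndex.zUpRight μ : ℚ) + (HamiltonianIndex.zUpLeft μ : ℚ)) / 2 ∧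
        -- the simplified formulas for `ζ`
        HamiltonianIndex.zeta L J μ =
          (HamiltonianIndex.dimGKer (J * L) : ℚ) / 2 - (HamiltonianIndex.zNeg μ : ℚ) ∧
        HamiltonianIndex.zeta L J μ =
          ((HamiltonianIndex.dimGKer (J * L) : ℚ) - 2 * (HamiltonianIndex.dimKer L : ℚ)) / 2
          + (HamiltonianIndex.zPos μ : ℚ) ∧
        (HamiltonianIndex.dimGKer (J * L) = 2 * HamiltonianIndex.dimKer L →
          HamiltonianIndex.zeta L J μ = (HamiltonianIndex.zPos μ : ℚ)) := by

  classical
  have hsymm := HamiltonianIndex.charpoly_pencil_neg hL hJ hJu I hI hLI hJI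
  refine ⟨HamiltonianIndex.charValues_finite hJu,
    HamiltonianIndex.exists_isEigenvalueCurves hL hJ, _,
    HamiltonianIndex.unstableMultiplicity_eq_two_mul hL hJ, fun μ hμ => ?_⟩
  have hunst := HamiltonianIndex.unstableMultiplicity_eq_two_mul hL hJ
  have htotal := HamiltonianIndex.card_eq_unstable_add_dimGKer_add (L := L) (J := J)
  have hmirror := HamiltonianIndex.card_filter_neg_eq_card_filter_pos hJu hsymm
  have hpos := HamiltonianIndex.two_mul_sumKreinPos hL hJ hμ hJu hsymm
  have hneg := HamiltonianIndex.two_mul_sumKreinNeg hL hJ hμ hJu hsymm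
  have hdown := HamiltonianIndex.zDownLeft_eq_zDownRight hμ hJu hsymm
  have hright : HamiltonianIndex.zDownRight μ + HamiltonianIndex.zUpRight μ =
      HamiltonianIndex.dimKer L :=
    (HamiltonianIndex.ncard_down_add_ncard_up fun j =>
      (HamiltonianIndex.eventually_neg_or_pos hμ hJu j).1).trans
      (HamiltonianIndex.dimKer_eq hμ hL).symm
  have hleft : HamiltonianIndex.zDownLeft μ + HamiltonianIndex.zUpLeft μ =
      HamiltonianIndex.dimKer L :=
    (HamiltonianIndex.ncard_down_add_ncard_up fun j =>
      (HamiltonianIndex.eventually_neg_or_pos hμ hJu j).2).trans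
      (HamiltonianIndex.dimKer_eq hμ hL).symm
  rw [hunst, hmirror] at htotal
  rw [hmirror] at hneg
  rw [hpos, hneg, HamiltonianIndex.negIndex_eq hμ hL, HamiltonianIndex.zeta,
    HamiltonianIndex.zNeg_eq_zDownRight hμ hJu, HamiltonianIndex.zPos_eq_zUpRight hμ hJu]
  have h1 := congrArg (Nat.cast : ℕ → ℚ) htotal
  have h2 := congrArg (Nat.cast : ℕ → ℚ) hdown
  have h3 := congrArg (Nat.cast : ℕ → ℚ) hright
  have h4 := congrArg (Nat.cast : ℕ → ℚ) hleft
  push_cast at h1 h3 h4 ⊢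
  -- All claims are now linear: `h1` eliminates the number of positive roots, `h2` equates the two
  -- down counts, and `h3`, `h4` exchange down for up counts.
  refine ⟨by linarith, by linarith, by linarith, by linarith, by linarith, fun hk => ?_⟩
  have h5 := congrArg (Nat.cast : ℕ → ℚ) hk
  push_cast at h5
  linarith
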